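/- Let $\mathcal U,\mathcal Y$ be complex Hilbert spaces, $\mathbb C^+=\{\mu\in\mathbb C:\operatorname{Re}\mu>0\}$, and let $\varphi$ be a Schur function on $\mathbb C^+$: a holomorphic $\mathcal B(\mathcal U,\mathcal Y)$-valued function whose values are contractions. Put $\widetilde\varphi(\mu)=\varphi(\overline\mu)^*$ and let $\mathcal H_c$ be the Hilbert space of functions $\mathbb C^+\to\mathcal U$ with reproducing kernel $$K_c(\mu,\lambda)=\frac{1-\widetilde\varphi(\mu)\varphi(\overline\lambda)}{\mu+\overline\lambda}.$$ Let $S=\left[\begin{smallmatrix}A\&B\\ C\&D\end{smallmatrix}\right]_c:\mathcal H_c\times\mathcal U\supset\operatorname{dom}S\to\mathcal H_c\times\mathcal Y$ be the closure of the linear operator determined by $$(K_c(\cdot,\overline\lambda)u,\,u)\mapsto(\lambda K_c(\cdot,\overline\lambda)u,\ \varphi(\lambda)u),\qquad \lambda\in\mathbb C^+,\ u\in\mathcal U,$$ and let $A_c$ be its main operator: $\operatorname{dom}A_c=\{x:(x,0)\in\operatorname{dom}S\}$ and $A_cx=[A\&B]_c(x,0)$. Fix $\beta\in\mathbb C^+$.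 Assume that for some $\alpha_0\in\mathbb C^+$ the only function of the form $\mu\mapsto\widetilde\varphi(\mu)y/(\alpha_0+\mu)$, $y\in\mathcal Y$, that belongs to $\mathcal H_c$ is $0$. Let $\mathcal H_{c,-1}$ be the set of functions $x:\mathbb C^+\to\mathcal U$ for which there is $y\in\mathcal Y$ with $$\mu\mapsto\frac{x(\mu)+\widetilde\varphi(\mu)y}{\beta+\mu}\ \in\mathcal H_c,\qquad(\ast)$$ taken modulo the functions $\widetilde\varphi(\cdot)\gamma$, $\gamma\in\mathcal Y$; write $[x]$ for the class of $x$. Then $(\ast)$ determines $\widetilde\varphi(\cdot)y$ uniquely, $\|[x]\|_{-1}=\left\|\mu\mapsto\frac{x(\mu)+\widetilde\varphi(\mu)y}{\beta+\mu}\right\|_{\mathcal H_c}$ is a well-defined norm on $\mathcal H_{c,-1}$, the space $\mathcal H_{c,-1}$ is complete, and the following hold. 1. $\beta$ lies in the resolvent set of $A_c$. The map $\iota:x\mapsto[x]$ is an injective continuous linear map of $\mathcal H_c$ onto a dense subspace of $\mathcal H_{c,-1}$, and $\|\iota x\|_{-1}=\|(\beta-A_c)^{-1}x\|_{\mathcal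 H_c}$; thus $\mathcal H_{c,-1}$ is the completion of $\mathcal H_c$ in the norm $\|(\beta-A_c)^{-1}x\|$. A given $[z]\in\mathcal H_{c,-1}$ lies in $\iota(\mathcal H_c)$ if and only if for some (equivalently, for every) $\alpha\in\mathbb C^+$ there is $y\in\mathcal Y$ such that $\mu\mapsto\frac{z(\mu)+\widetilde\varphi(\mu)y}{\alpha+\mu}$ belongs to $\operatorname{dom}A_c$. 2. The formula $A_c|_{\mathcal H_c}x=[\mu\mapsto-\mu x(\mu)]$, $x\in\mathcal H_c$, defines a continuous linear operator $\mathcal H_c\to\mathcal H_{c,-1}$, and it is the unique continuous linear operator that extends $A_c$, i.e. that maps each $x\in\operatorname{dom}A_c$ to $\iota A_cx$. The operator $\beta-A_c|_{\mathcal H_c}$ (that is, $x\mapsto\beta\iota x-A_c|_{\mathcal H_c}x$) is a bijection of $\mathcal H_c$ onto $\mathcal H_{c,-1}$, its inverse is unitary from $\mathcal H_{c,-1}$ onto $\mathcal H_c$, and $$\big((\beta-A_c|_{\mathcal H_c})^{-1}[x]\big)(\mu)=\frac{x(\mu)+\widetilde\varphi(\mu)y}{\beta+\mu},\qquad[x]\in\mathcal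 H_{c,-1},\ \mu\in\mathbb C^+,$$ where $y$ is any vector satisfying $(\ast)$. 3. The formula $B_cu=[\mu\mapsto u]$, $u\in\mathcal U$, defines a continuous linear operator $\mathcal U\to\mathcal H_{c,-1}$, and it is the control operator of $S$: the unique continuous linear operator such that $\iota\,[A\&B]_c(x,u)=A_c|_{\mathcal H_c}x+B_cu$ for all $(x,u)\in\operatorname{dom}S$. Moreover $\operatorname{dom}S=\{(x,u)\in\mathcal H_c\times\mathcal U: A_c|_{\mathcal H_c}x+B_cu\in\iota(\mathcal H_c)\}$. -/

import Mathlib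

open ComplexConjugate Filter Topology

noncomputable section

namespace ExtrapModel

/-- The open right half-plane. -/
abbrev CPlus : Type := {z : ℂ // 0 < z.re}

/-- Complex conjugation as a map of the right half-plane into itself. -/
def CPlus.conj (μ : CPlus) : CPlus := ⟨starRingEnd ℂ (μ : ℂ), by simpa using μ.2⟩

/-- The Schur class on the right half-plane: holomorphic functions with values in the contractions
from `U` to `Y`. Only the values of `toFun` at points of positive real part are ever used. -/
structure SchurClass (U Y : Type*)
    [NormedAddCommGroup U] [InnerProductSpace ℂ U]
    [NormedAddCommGroup Y] [InnerProductSpace ℂ Y] where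
  toFun : ℂ → (U →L[ℂ] Y)
  holo : DifferentiableOn ℂ toFun {z : ℂ | 0 < z.re}
  contractive : ∀ z : ℂ, 0 < z.re → ‖toFun z‖ ≤ 1

/-- The value of a Schur function at a point of the right half-plane. -/
def SchurClass.app {U Y : Type*}
    [NormedAddCommGroup U] [InnerProductSpace ℂ U]
    [NormedAddCommGroup Y] [InnerProductSpace ℂ Y]
    (φ : SchurClass U Y) (μ : CPlus) : U →L[ℂ] Y := φ.toFun (μ : ℂ)

variable {U Y : Type*}
    [NormedAddCommGroup U] [InnerProductSpace ℂ U] [CompleteSpace U]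
    [NormedAddCommGroup Y] [InnerProductSpace ℂ Y] [CompleteSpace Y]

/-- The function `μ ↦ φ(conj μ)*`, with values in the bounded operators from `Y` to `U`. -/
def SchurClass.tilde (φ : SchurClass U Y) (μ : CPlus) : Y →L[ℂ] U :=
  ContinuousLinearMap.adjoint (φ.app μ.conj)

/-- The kernel `K(μ, lam) = (1 - φ(conj μ)* φ(conj lam)) / (μ + conj lam)`. -/
def SchurClass.kernel (φ : SchurClass U Y) : Matrix CPlus CPlus (U →L[ℂ] U) :=
  Matrix.of fun μ lam =>
    ((μ : ℂ) + starRingEnd ℂ (lam : ℂ))⁻¹ •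
      (ContinuousLinearMap.id ℂ U - φ.tilde μ ∘L φ.app lam.conj)

/-! ### Positivity of the kernel -/

section Positivity

/-- The Szegő kernel of the disc with centre `c` and radius `r`. -/
def szego (c r : ℝ) (w z : ℂ) : ℂ :=
  (r : ℂ) ^ 2 / ((r : ℂ) ^ 2 - (z - c) * starRingEnd ℂ (w - c))

lemma szego_den_ne {c r : ℝ} {w z : ℂ} (hr : 0 < r)
    (hw : w ∈ Metric.ball (c : ℂ) r) (hz : z ∈ Metric.closedBall (c : ℂ) r) :
    (r : ℂ) ^ 2 - (z - c) * starRingEnd ℂ (w - c) ≠ 0 := by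
  intro h
  have h1 : ‖(r : ℂ) ^ 2‖ = ‖(z - c) * starRingEnd ℂ (w - c)‖ := by
    rw [sub_eq_zero.mp h]
  rw [norm_mul, norm_pow, RCLike.norm_conj, Complex.norm_real, Real.norm_of_nonneg hr.le] at h1
  rw [mem_ball_iff_norm] at hw
  rw [mem_closedBall_iff_norm] at hz
  nlinarith [norm_nonneg (z - c), norm_nonneg (w - c)]

lemma szego_differentiableOn {c r : ℝ} {w : ℂ} (hr : 0 < r)
    (hw : w ∈ Metric.ball (c : ℂ) r) :
    DifferentiableOn ℂ (szego c r w) (Metric.closedBall (c : ℂ) r) := by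
  intro z hz
  unfold szego
  have := szego_den_ne hr hw hz
  apply DifferentiableAt.differentiableWithinAt
  fun_prop (disch := assumption)

lemma szego_reproducing {V : Type*} [NormedAddCommGroup V] [InnerProductSpace ℂ V]
    {c r : ℝ} {w : ℂ} (hr : 0 < r) (hw : w ∈ Metric.ball (c : ℂ) r) (u : V) {h : ℂ → V}
    (hh : DifferentiableOn ℂ h (Metric.closedBall (c : ℂ) r)) :
    Real.circleAverage (fun z => inner ℂ (szego c r w z • u) (h z)) c r = inner ℂ u (h w) := by
  rw [Real.circleAverage_eq_circleIntegral hr.ne']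
  have h2 : (∮ z in C((c : ℂ), r), (z - c)⁻¹ • inner ℂ (szego c r w z • u) (h z)) =
      ∮ z in C((c : ℂ), r), (z - w)⁻¹ • inner ℂ u (h z) := by
    apply circleIntegral.integral_congr hr.le
    intro z hz
    have hz' : ‖z - c‖ = r := by simpa [mem_sphere_iff_norm] using hz
    have hzc : z - c ≠ 0 := by
      intro h0; rw [h0, norm_zero] at hz'; exact hr.ne hz'
    have hden := szego_den_ne hr hw (Metric.sphere_subset_closedBall hz)
    have hconj : (z - c) * starRingEnd ℂ (z - c) = (r : ℂ) ^ 2 := by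
      rw [Complex.mul_conj, Complex.normSq_eq_norm_sq, hz']; push_cast; rfl
    have hzw : z - w ≠ 0 := by
      intro h0
      apply hden
      rw [← hconj, sub_eq_zero.mp h0]; ring
    have hden' : starRingEnd ℂ ((r : ℂ) ^ 2 - (z - c) * starRingEnd ℂ (w - c)) ≠ 0 := by
      rwa [Ne, map_eq_zero]
    simp only [inner_smul_left, smul_eq_mul]
    rw [← mul_assoc]
    congr 1
    unfold szego
    rw [map_div₀]
    have e : starRingEnd ℂ ((r : ℂ) ^ 2 - (z - c) * starRingEnd ℂ (w - c)) =
        starRingEnd ℂ (z - c) * (z - w) := by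
      rw [← hconj]; simp only [map_sub, map_mul, Complex.conj_conj, Complex.conj_ofReal]; ring
    have e2 : starRingEnd ℂ ((r : ℂ) ^ 2) = (z - c) * starRingEnd ℂ (z - c) := by
      rw [hconj]; simp
    rw [e] at hden' ⊢
    rw [e2]
    have hc : starRingEnd ℂ (z - c) ≠ 0 := left_ne_zero_of_mul hden'
    field_simp
  rw [h2]
  have h3 : DifferentiableOn ℂ (fun z => (inner ℂ u (h z) : ℂ)) (Metric.closedBall (c : ℂ) r) :=
    (innerSL ℂ u).differentiable.comp_differentiableOn hh
  rw [h3.circleIntegral_sub_inv_smul hw, smul_smul, inv_mul_cancel₀, one_smul]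
  simp [Real.pi_ne_zero]

lemma szego_reproducing_sum {V : Type*} [NormedAddCommGroup V] [InnerProductSpace ℂ V]
    {ι : Type*} (s : Finset ι) {c r : ℝ} (w : ι → ℂ) (hr : 0 < r)
    (hw : ∀ i ∈ s, w i ∈ Metric.ball (c : ℂ) r) (u : ι → V) {h : ℂ → V}
    (hh : DifferentiableOn ℂ h (Metric.closedBall (c : ℂ) r)) :
    Real.circleAverage (fun z => inner ℂ (∑ i ∈ s, szego c r (w i) z • u i) (h z)) c r =
      ∑ i ∈ s, inner ℂ (u i) (h (w i)) := by
  simp only [sum_inner]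
  have key := Real.circleAverage_sum (c := (c : ℂ)) (R := r) (s := s)
    (f := fun i z => (inner ℂ (szego c r (w i) z • u i) (h z) : ℂ)) ?_
  · have e : (fun z => ∑ i ∈ s, (inner ℂ (szego c r (w i) z • u i) (h z) : ℂ)) =
        ∑ i ∈ s, fun z => (inner ℂ (szego c r (w i) z • u i) (h z) : ℂ) := by
      ext z; simp
    rw [e, key]
    exact Finset.sum_congr rfl fun i hi => szego_reproducing hr (hw i hi) (u i) hh
  · intro i hi
    apply ContinuousOn.circleIntegrable hr.le
    have := ((szego_differentiableOn hr (hw i hi)).continuousOn.mono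
      Metric.sphere_subset_closedBall)
    exact (this.smul continuousOn_const).inner
      (hh.continuousOn.mono Metric.sphere_subset_closedBall)

lemma disc_positive {ι : Type*} (s : Finset ι) {c r : ℝ} (w : ι → ℂ) (hr : 0 < r)
    (hw : ∀ i ∈ s, w i ∈ Metric.ball (c : ℂ) r) (u : ι → U) {ψ : ℂ → (Y →L[ℂ] U)}
    (hψ : DifferentiableOn ℂ ψ (Metric.closedBall (c : ℂ) r))
    (hψ1 : ∀ z ∈ Metric.closedBall (c : ℂ) r, ‖ψ z‖ ≤ 1) :
    0 ≤ (∑ j ∈ s, ∑ i ∈ s, szego c r (w i) (w j) *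
      (inner ℂ (u j) (u i) - inner ℂ (ContinuousLinearMap.adjoint (ψ (w j)) (u j))
        (ContinuousLinearMap.adjoint (ψ (w i)) (u i)))).re := by
  set v : ι → Y := fun i => ContinuousLinearMap.adjoint (ψ (w i)) (u i) with hv
  set f : ℂ → U := fun z => ∑ i ∈ s, szego c r (w i) z • u i with hf
  set g : ℂ → Y := fun z => ∑ i ∈ s, szego c r (w i) z • v i with hg
  have hfd : DifferentiableOn ℂ f (Metric.closedBall (c : ℂ) r) :=
    DifferentiableOn.fun_sum fun i hi => (szego_differentiableOn hr (hw i hi)).smul_const _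
  have hgd : DifferentiableOn ℂ g (Metric.closedBall (c : ℂ) r) :=
    DifferentiableOn.fun_sum fun i hi => (szego_differentiableOn hr (hw i hi)).smul_const _
  have hψg : DifferentiableOn ℂ (fun z => ψ z (g z)) (Metric.closedBall (c : ℂ) r) :=
    hψ.clm_apply hgd
  have hh1 : DifferentiableOn ℂ (fun z => f z - (2 : ℂ) • ψ z (g z))
    (Metric.closedBall (c : ℂ) r) := hfd.sub (hψg.const_smul (2 : ℂ))
  have a1 := szego_reproducing_sum s w hr hw u hh1
  have a2 := szego_reproducing_sum s w hr hw v hgd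
  have sub := Metric.sphere_subset_closedBall (x := (c : ℂ)) (ε := r)
  have i1 : CircleIntegrable (fun z => (inner ℂ (f z) (f z - (2 : ℂ) • ψ z (g z)) : ℂ)) c r :=
    ((hfd.continuousOn.mono sub).inner (hh1.continuousOn.mono sub)).circleIntegrable hr.le
  have i2 : CircleIntegrable (fun z => (inner ℂ (g z) (g z) : ℂ)) c r :=
    ((hgd.continuousOn.mono sub).inner (hgd.continuousOn.mono sub)).circleIntegrable hr.le
  have a3 := Real.circleAverage_add i1 i2
  have e : (∑ j ∈ s, ∑ i ∈ s, szego c r (w i) (w j) *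
      (inner ℂ (u j) (u i) - inner ℂ (v j) (v i))) =
      Real.circleAverage ((fun z => (inner ℂ (f z) (f z - (2 : ℂ) • ψ z (g z)) : ℂ)) +
        fun z => (inner ℂ (g z) (g z) : ℂ)) c r := by
    rw [a3, a1, a2, ← Finset.sum_add_distrib]
    refine Finset.sum_congr rfl fun j _ => ?_
    have e1 : (inner ℂ (u j) (ψ (w j) (g (w j))) : ℂ) = inner ℂ (v j) (g (w j)) := by
      rw [hv, ContinuousLinearMap.adjoint_inner_left]
    rw [inner_sub_right, inner_smul_right, e1]
    simp only [hf, hg, inner_sum, inner_smul_right, mul_sub, Finset.sum_sub_distrib]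
    ring
  rw [e]
  have i3 := i1.add i2
  have e4 := (Complex.reCLM).circleAverage_comp_comm i3
  have e5 : Real.circleAverage (Complex.reCLM ∘
      ((fun z => (inner ℂ (f z) (f z - (2 : ℂ) • ψ z (g z)) : ℂ)) +
        fun z => (inner ℂ (g z) (g z) : ℂ))) c r =
      (Real.circleAverage ((fun z => (inner ℂ (f z) (f z - (2 : ℂ) • ψ z (g z)) : ℂ)) +
        fun z => (inner ℂ (g z) (g z) : ℂ)) c r).re := e4
  rw [← e5]
  apply Real.circleAverage_nonneg_of_nonneg
  intro z hz
  rw [abs_of_pos hr] at hz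
  have hz1 := hψ1 z (sub hz)
  have b1 : ‖ψ z (g z)‖ ≤ ‖g z‖ := by
    simpa using (ψ z).le_of_opNorm_le hz1 (g z)
  have b2 : ‖f z - ψ z (g z)‖ ^ 2 =
      ‖f z‖ ^ 2 - 2 * (inner ℂ (f z) (ψ z (g z)) : ℂ).re + ‖ψ z (g z)‖ ^ 2 := by
    simpa using norm_sub_sq (𝕜 := ℂ) (f z) (ψ z (g z))
  have b3 : (inner ℂ (f z) (f z) : ℂ).re = ‖f z‖ ^ 2 := by
    simpa using inner_self_eq_norm_sq (𝕜 := ℂ) (f z)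
  have b4 : (inner ℂ (g z) (g z) : ℂ).re = ‖g z‖ ^ 2 := by
    simpa using inner_self_eq_norm_sq (𝕜 := ℂ) (g z)
  simp only [Function.comp, Pi.add_apply, Complex.reCLM_apply, Complex.add_re, inner_sub_right,
    inner_smul_right, Complex.sub_re, Complex.mul_re, Complex.re_ofNat, Complex.im_ofNat, zero_mul,
    sub_zero, b3, b4]
  nlinarith [sq_nonneg ‖f z - ψ z (g z)‖, norm_nonneg (ψ z (g z)), norm_nonneg (g z)]

lemma tilde_holo (φ : SchurClass U Y) :
    DifferentiableOn ℂ
      (fun z => ContinuousLinearMap.adjoint (φ.toFun (starRingEnd ℂ z))) {z : ℂ | 0 < z.re} := by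
  intro z hz
  apply DifferentiableAt.differentiableWithinAt
  have hz' : (starRingEnd ℂ z) ∈ {z : ℂ | 0 < z.re} := by simpa using hz
  have hopen : IsOpen {z : ℂ | 0 < z.re} := isOpen_lt continuous_const Complex.continuous_re
  have hd := ((φ.holo _ hz').differentiableAt (hopen.mem_nhds hz')).hasDerivAt
  rw [hasDerivAt_iff_tendsto_slope] at hd
  have hc : Tendsto (fun w : ℂ => starRingEnd ℂ w) (𝓝[≠] z) (𝓝[≠] (starRingEnd ℂ z)) := by
    apply tendsto_nhdsWithin_of_tendsto_nhds_of_eventually_within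
    · exact (Complex.continuous_conj.tendsto z).mono_left nhdsWithin_le_nhds
    · filter_upwards [self_mem_nhdsWithin] with w hw h
      exact hw ((starRingEnd ℂ).injective h)
  have h3 := ((ContinuousLinearMap.adjoint (𝕜 := ℂ) (E := U) (F := Y)).continuous.tendsto _).comp
    (hd.comp hc)
  apply HasDerivAt.differentiableAt
  rw [hasDerivAt_iff_tendsto_slope]
  refine h3.congr fun w => ?_
  simp only [slope, Function.comp_apply, vsub_eq_sub]
  rw [map_smulₛₗ, map_sub]
  simp

lemma kernel_isHermitian (φ : SchurClass U Y) : φ.kernel.IsHermitian := by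
  ext μ lam : 1
  simp only [Matrix.conjTranspose_apply, SchurClass.kernel, Matrix.of_apply, star_smul, star_sub,
    ContinuousLinearMap.star_eq_adjoint, SchurClass.tilde, ContinuousLinearMap.adjoint_comp,
    ContinuousLinearMap.adjoint_adjoint, ContinuousLinearMap.adjoint_id]
  simp [add_comm]

/-- The kernel is positive. -/
lemma kernel_posSemidef (φ : SchurClass U Y) : φ.kernel.PosSemidef := by
  have tfae := (RKHS.posSemidef_tfae (K := φ.kernel)).out 0 2
  rw [tfae]
  refine ⟨kernel_isHermitian φ, fun vv => ?_⟩
  set ψ : ℂ → (Y →L[ℂ] U) := fun z => ContinuousLinearMap.adjoint (φ.toFun (starRingEnd ℂ z))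
    with hψ
  set s := vv.support
  let co : CPlus → CPlus → ℂ := fun j i =>
    inner ℂ (vv j) (vv i) - inner ℂ (ContinuousLinearMap.adjoint (ψ j) (vv j))
        (ContinuousLinearMap.adjoint (ψ i) (vv i))
  have e0 : (vv.sum fun x w ↦ vv.sum fun x' w' ↦ (inner ℂ (φ.kernel x' x w) w' : ℂ)) =
      ∑ j ∈ s, ∑ i ∈ s, ((j : ℂ) + starRingEnd ℂ (i : ℂ))⁻¹ * co j i := by
    simp only [Finsupp.sum]
    refine Finset.sum_congr rfl fun j _ => Finset.sum_congr rfl fun i _ => ?_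
    simp [SchurClass.kernel, SchurClass.tilde, co, hψ,
      ContinuousLinearMap.adjoint_inner_left, CPlus.conj, SchurClass.app, add_comm]
    ring
  rw [e0]
  have hlim : Tendsto (fun c : ℝ => ∑ j ∈ s, ∑ i ∈ s,
      ((j : ℂ) + starRingEnd ℂ (i : ℂ) - ((c : ℂ))⁻¹ * (1 + (j : ℂ) * starRingEnd ℂ (i : ℂ)))⁻¹
        * co j i) atTop
      (𝓝 (∑ j ∈ s, ∑ i ∈ s, ((j : ℂ) + starRingEnd ℂ (i : ℂ))⁻¹ * co j i)) := by
    refine tendsto_finsetSum _ fun j _ => tendsto_finsetSum _ fun i _ => ?_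
    refine Tendsto.mul_const _ ?_
    refine Tendsto.inv₀ ?_ ?_
    · have : Tendsto (fun c : ℝ => ((c : ℂ))⁻¹) atTop (𝓝 0) := by
        have := (Complex.continuous_ofReal.tendsto 0).comp tendsto_inv_atTop_zero (α := ℝ)
        simpa [Function.comp_def] using this
      simpa using (this.mul_const (1 + (j : ℂ) * starRingEnd ℂ (i : ℂ))).const_sub
        ((j : ℂ) + starRingEnd ℂ (i : ℂ))
    · intro h
      have := congrArg Complex.re h
      simp at this
      linarith [j.2, i.2]
  have hre := (Complex.continuous_re.tendsto _).comp hlim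
  refine ge_of_tendsto hre ?_
  have hev : ∀ᶠ c : ℝ in atTop, ∀ i ∈ s, 1 + ‖(i : ℂ)‖ ^ 2 < 2 * c * (i : ℂ).re := by
    rw [eventually_all_finset]
    intro i _
    have : Tendsto (fun c : ℝ => 2 * c * (i : ℂ).re) atTop atTop :=
      (tendsto_id.const_mul_atTop (two_pos)).atTop_mul_const i.2
    exact this.eventually_gt_atTop _
  filter_upwards [hev, eventually_gt_atTop 1] with c hc hc1
  set r : ℝ := Real.sqrt (c ^ 2 - 1) with hrdef
  have hr2 : r ^ 2 = c ^ 2 - 1 := Real.sq_sqrt (by nlinarith)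
  have hr : 0 < r := Real.sqrt_pos.mpr (by nlinarith)
  have hrc : r < c := by nlinarith
  have hsub : Metric.closedBall (c : ℂ) r ⊆ {z : ℂ | 0 < z.re} := by
    intro z hz
    rw [mem_closedBall_iff_norm] at hz
    have := (Complex.abs_re_le_norm (z - c)).trans hz
    simp only [Complex.sub_re, Complex.ofReal_re] at this
    have := (abs_le.mp this).1
    simp only [Set.mem_ofPred_eq]
    linarith
  have hw : ∀ i ∈ s, (i : ℂ) ∈ Metric.ball (c : ℂ) r := by
    intro i hi
    rw [mem_ball_iff_norm]
    have h1 := hc i hi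
    have h2 : ‖(i : ℂ) - c‖ ^ 2 = ‖(i : ℂ)‖ ^ 2 - 2 * c * (i : ℂ).re + c ^ 2 := by
      rw [← Complex.normSq_eq_norm_sq, ← Complex.normSq_eq_norm_sq, Complex.normSq_apply,
        Complex.normSq_apply]
      simp; ring
    refine lt_of_pow_lt_pow_left₀ 2 hr.le ?_
    rw [h2, hr2]; linarith
  have main := disc_positive (U := U) (Y := Y) s (c := c) (r := r) (fun i : CPlus => (i : ℂ)) hr hw
    (fun i => vv i) (ψ := ψ) ((tilde_holo φ).mono hsub) (by
      intro z hz
      simp only [hψ, LinearIsometryEquiv.norm_map]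
      exact φ.contractive _ (by simpa using hsub hz))
  have hcr : (0 : ℝ) < c / r ^ 2 := by positivity
  have e1 : (∑ j ∈ s, ∑ i ∈ s,
      ((j : ℂ) + starRingEnd ℂ (i : ℂ) - ((c : ℂ))⁻¹ * (1 + (j : ℂ) * starRingEnd ℂ (i : ℂ)))⁻¹
        * co j i) = ((c / r ^ 2 : ℝ) : ℂ) * ∑ j ∈ s, ∑ i ∈ s, szego c r (i : ℂ) (j : ℂ) * co j i := by
    rw [Finset.mul_sum]
    refine Finset.sum_congr rfl fun j hj => ?_
    rw [Finset.mul_sum]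
    refine Finset.sum_congr rfl fun i hi => ?_
    rw [← mul_assoc]
    congr 1
    have hden := szego_den_ne hr (hw i hi) (Metric.ball_subset_closedBall (hw j hj))
    have hc0 : (c : ℂ) ≠ 0 := by exact_mod_cast (by linarith : c ≠ 0)
    have hr0 : (r : ℂ) ≠ 0 := by exact_mod_cast hr.ne'
    have hr2' : (r : ℂ) ^ 2 = (c : ℂ) ^ 2 - 1 := by exact_mod_cast hr2
    have hd : (r : ℂ) ^ 2 - ((j : ℂ) - c) * starRingEnd ℂ ((i : ℂ) - c) =
        c * ((j : ℂ) + starRingEnd ℂ (i : ℂ) -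
          ((c : ℂ))⁻¹ * (1 + (j : ℂ) * starRingEnd ℂ (i : ℂ))) := by
      rw [hr2']
      simp only [map_sub, Complex.conj_ofReal]
      field_simp
      ring
    unfold szego
    rw [hd] at hden ⊢
    have hden2 := right_ne_zero_of_mul hden
    push_cast
    rw [div_mul_div_comm, eq_div_iff (mul_ne_zero (pow_ne_zero 2 hr0) hden)]
    have h1 := inv_mul_cancel₀ hden2
    linear_combination ((r : ℂ) ^ 2 * c) * h1
  show 0 ≤ Complex.re _
  beta_reduce
  rw [e1, Complex.re_ofReal_mul]
  exact mul_nonneg hcr.le main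

end Positivity

/-! ### The state space and the system node -/

instance kernel_fact (φ : SchurClass U Y) : Fact φ.kernel.PosSemidef := ⟨kernel_posSemidef φ⟩

/-- The de Branges–Rovnyak space: the reproducing kernel Hilbert space of `U`-valued functions on
the right half-plane with kernel `φ.kernel`. -/
abbrev StateSpace (φ : SchurClass U Y) : Type _ := RKHS.OfKernel φ.kernel

/-- The kernel function `K(·, lam) u`, i.e. the adjoint of the evaluation at `lam` applied to `u`. -/
def kerVec (φ : SchurClass U Y) (lam : CPlus) (u : U) : StateSpace φ :=
  RKHS.kerFun (StateSpace φ) lam u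

lemma kerVec_apply (φ : SchurClass U Y) (lam : CPlus) (u : U) (μ : CPlus) :
    kerVec φ lam u μ =
      ((μ : ℂ) + starRingEnd ℂ (lam : ℂ))⁻¹ • (u - φ.tilde μ (φ.app lam.conj u)) := by
  rw [kerVec, RKHS.kerFun_apply, RKHS.OfKernel.kernel_ofKernel]
  rfl

lemma inner_kerVec (φ : SchurClass U Y) (x : StateSpace φ) (lam : CPlus) (u : U) :
    (inner ℂ x (kerVec φ lam u) : ℂ) = inner ℂ (x lam) u := by
  rw [kerVec, RKHS.inner_kerFun]

/-- The set of the pairs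
`((K(·, conj lam) u, u), (lam K(·, conj lam) u, φ(lam) u))` that determine the system node. -/
def nodeGenerators (φ : SchurClass U Y) :
    Set ((StateSpace φ × U) × (StateSpace φ × Y)) :=
  {p | ∃ (lam : CPlus) (u : U),
    p = ((kerVec φ lam.conj u, u), ((lam : ℂ) • kerVec φ lam.conj u, φ.app lam u))}

/-- The graph of the system node: the closed linear span of the generating pairs. -/
def nodeGraph (φ : SchurClass U Y) :
    Submodule ℂ ((StateSpace φ × U) × (StateSpace φ × Y)) :=
  (Submodule.span ℂ (nodeGenerators φ)).topologicalClosure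

/-- The controllable energy-preserving model `[A&B; C&D]` of `φ`: the closure of the operator which
maps `(K(·, conj lam) u, u)` to `(lam K(·, conj lam) u, φ(lam) u)`. -/
def node (φ : SchurClass U Y) : (StateSpace φ × U) →ₗ.[ℂ] (StateSpace φ × Y) :=
  (nodeGraph φ).toLinearPMap

/-- The polarized energy balance on the graph of the system node. -/
lemma nodeGraph_balance (φ : SchurClass U Y)
    {p q : (StateSpace φ × U) × (StateSpace φ × Y)} (hp : p ∈ nodeGraph φ) (hq : q ∈ nodeGraph φ) :
    (inner ℂ p.1.2 q.1.2 : ℂ) - inner ℂ p.2.2 q.2.2 =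
      inner ℂ p.2.1 q.1.1 + inner ℂ p.1.1 q.2.1 := by
  have gen : ∀ p ∈ nodeGenerators φ, ∀ q ∈ nodeGenerators φ,
      (inner ℂ p.1.2 q.1.2 : ℂ) - inner ℂ p.2.2 q.2.2 =
      inner ℂ p.2.1 q.1.1 + inner ℂ p.1.1 q.2.1 := by
    rintro _ ⟨l, u, rfl⟩ _ ⟨m, v, rfl⟩
    have hne : starRingEnd ℂ (m : ℂ) + (l : ℂ) ≠ 0 := by
      intro h
      have := congrArg Complex.re h
      simp at this
      linarith [l.2, m.2]
    have hne' : (m : ℂ) + starRingEnd ℂ (l : ℂ) ≠ 0 := by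
      intro h
      have := congrArg Complex.re h
      simp at this
      linarith [l.2, m.2]
    have hcc : ∀ m : CPlus, m.conj.conj = m := fun m => Subtype.ext (by simp [CPlus.conj])
    simp only [inner_smul_left, inner_smul_right, inner_kerVec, kerVec_apply, inner_sub_left,
      SchurClass.tilde, ContinuousLinearMap.adjoint_inner_left, hcc]
    simp only [CPlus.conj, Complex.conj_conj, map_inv₀, map_add]
    field_simp
    ring
  have step1 : ∀ p ∈ nodeGenerators φ, ∀ q ∈ nodeGraph φ,
      (inner ℂ p.1.2 q.1.2 : ℂ) - inner ℂ p.2.2 q.2.2 =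
      inner ℂ p.2.1 q.1.1 + inner ℂ p.1.1 q.2.1 := by
    intro p hp q hq
    refine closure_minimal (t := {q : (StateSpace φ × U) × (StateSpace φ × Y) |
      (inner ℂ p.1.2 q.1.2 : ℂ) - inner ℂ p.2.2 q.2.2 =
      inner ℂ p.2.1 q.1.1 + inner ℂ p.1.1 q.2.1}) ?_ (isClosed_eq (by fun_prop) (by fun_prop)) hq
    intro q hq
    induction hq using Submodule.span_induction with
    | mem q hq => exact gen p hp q hq
    | zero => simp
    | add a b _ _ ha hb =>
      simp only [Set.mem_ofPred_eq, Prod.fst_add, Prod.snd_add, inner_add_right] at *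
      linear_combination ha + hb
    | smul c a _ ha =>
      simp only [Set.mem_ofPred_eq, Prod.smul_fst, Prod.smul_snd, inner_smul_right] at *
      linear_combination c * ha
  refine closure_minimal (t := {p : (StateSpace φ × U) × (StateSpace φ × Y) |
      (inner ℂ p.1.2 q.1.2 : ℂ) - inner ℂ p.2.2 q.2.2 =
      inner ℂ p.2.1 q.1.1 + inner ℂ p.1.1 q.2.1}) ?_ (isClosed_eq (by fun_prop) (by fun_prop)) hp
  intro p hp
  induction hp using Submodule.span_induction with
  | mem p hp => exact step1 p hp q hq
  | zero => simp
  | add a b _ _ ha hb =>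
    simp only [Set.mem_ofPred_eq, Prod.fst_add, Prod.snd_add, inner_add_left] at *
    linear_combination ha + hb
  | smul c a _ ha =>
    simp only [Set.mem_ofPred_eq, Prod.smul_fst, Prod.smul_snd, inner_smul_left] at *
    linear_combination (starRingEnd ℂ c) * ha

/-- The closed span is single-valued, so the system node is a well-defined closed operator. -/
lemma nodeGraph_single_valued (φ : SchurClass U Y)
    (p : (StateSpace φ × U) × (StateSpace φ × Y)) (hp : p ∈ nodeGraph φ) (h0 : p.1 = 0) :
    p.2 = 0 := by
  have hy : p.2.2 = 0 := by
    have := nodeGraph_balance φ hp hp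
    simpa [h0] using this
  have hz : p.2.1 = 0 := by
    refine RKHS.ext fun μ => ?_
    refine ext_inner_right ℂ fun v => ?_
    have hq : ((kerVec φ μ v, v), ((μ.conj : ℂ) • kerVec φ μ v, φ.app μ.conj v)) ∈ nodeGraph φ := by
      apply Submodule.le_topologicalClosure
      apply Submodule.subset_span
      have hcc : μ.conj.conj = μ := Subtype.ext (by simp [CPlus.conj])
      exact ⟨μ.conj, v, by rw [hcc]⟩
    have := nodeGraph_balance φ hp hq
    simp only [h0, hy, Prod.fst_zero, Prod.snd_zero, inner_zero_left, sub_zero, add_zero,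
      inner_kerVec] at this
    simpa using this.symm
  exact Prod.ext hz hy

lemma node_graph (φ : SchurClass U Y) : (node φ).graph = nodeGraph φ :=
  Submodule.toLinearPMap_graph_eq _ (nodeGraph_single_valued φ)

/-- The main operator of `S = [A&B; C&D]`: `A x = [A&B] (x, 0)` for all `x` with
`(x, 0)` in the domain of `S`. -/
def mainOperator {X U Y : Type*} [AddCommGroup X] [Module ℂ X] [AddCommGroup U] [Module ℂ U]
    [AddCommGroup Y] [Module ℂ Y] (S : (X × U) →ₗ.[ℂ] (X × Y)) : X →ₗ.[ℂ] X where
  domain := S.domain.comap (LinearMap.inl ℂ X U)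
  toFun :=
    { toFun := fun x => (S ⟨((x : X), 0), x.2⟩).1
      map_add' := fun x y => by
        rw [← Prod.fst_add, ← LinearPMap.map_add]
        congr 2
        exact Subtype.ext (by simp)
      map_smul' := fun c x => by
        rw [RingHom.id_apply, ← Prod.smul_fst, ← LinearPMap.map_smul]
        congr 2
        exact Subtype.ext (by simp) }

/-- `a` lies in the resolvent set of `A`, and `R = (a - A)⁻¹`. -/
def IsResolventAt {X : Type*} [NormedAddCommGroup X] [NormedSpace ℂ X]
    (A : X →ₗ.[ℂ] X) (a : ℂ) (R : X →L[ℂ] X) : Prop :=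
  (∀ x : X, ∃ z : A.domain, (z : X) = R x ∧ a • (z : X) - A z = x) ∧
    ∀ z : A.domain, R (a • (z : X) - A z) = z

/-! ### The concrete extrapolation space -/

/-- `h` lies in the state space and `h(μ) = (x(μ) + φ(conj μ)* y) / (a + μ)` on the
right half-plane. -/
def IsQuotientFor (φ : SchurClass U Y) (a : CPlus) (x : CPlus → U) (y : Y)
    (h : StateSpace φ) : Prop :=
  ∀ μ : CPlus, h μ = ((a : ℂ) + (μ : ℂ))⁻¹ • (x μ + φ.tilde μ y)

lemma add_coe_ne_zero (a μ : CPlus) : (a : ℂ) + (μ : ℂ) ≠ 0 := by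
  intro h
  have := congrArg Complex.re h
  simp at this
  linarith [a.2, μ.2]

/-- The functions `x` for which `(x(μ) + φ(conj μ)* y) / (b + μ)` lies in the state space for some
`y`. -/
def extrapFunctions (φ : SchurClass U Y) (b : CPlus) : Submodule ℂ (CPlus → U) where
  carrier := {x | ∃ (y : Y) (h : StateSpace φ), IsQuotientFor φ b x y h}
  zero_mem' := ⟨0, 0, fun μ => by simp⟩
  add_mem' := by
    rintro x x' ⟨y, h, hh⟩ ⟨y', h', hh'⟩
    refine ⟨y + y', h + h', fun μ => ?_⟩
    rw [RKHS.coe_add, Pi.add_apply, hh μ, hh' μ, ← smul_add, Pi.add_apply, map_add]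
    congr 1
    abel
  smul_mem' := by
    rintro c x ⟨y, h, hh⟩
    refine ⟨c • y, c • h, fun μ => ?_⟩
    rw [RKHS.coe_smul, Pi.smul_apply, hh μ, smul_comm, Pi.smul_apply, map_smul, smul_add]

/-- The subspace of all functions `μ ↦ φ(conj μ)* y` with `y` in `Y`. -/
def tildeRange (φ : SchurClass U Y) : Submodule ℂ (CPlus → U) :=
  LinearMap.range (LinearMap.pi fun μ => (φ.tilde μ : Y →ₗ[ℂ] U))

/-- The concrete extrapolation space: classes of functions in `extrapFunctions φ b` modulo the
functions `μ ↦ φ(conj μ)* y`. -/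
def ExtrapSpace (φ : SchurClass U Y) (b : CPlus) : Type _ :=
  extrapFunctions φ b ⧸ (tildeRange φ).submoduleOf (extrapFunctions φ b)

namespace ExtrapSpace

variable (φ : SchurClass U Y) (b : CPlus)

instance : AddCommGroup (ExtrapSpace φ b) :=
  inferInstanceAs (AddCommGroup
    (extrapFunctions φ b ⧸ (tildeRange φ).submoduleOf (extrapFunctions φ b)))

instance : Module ℂ (ExtrapSpace φ b) :=
  inferInstanceAs (Module ℂ
    (extrapFunctions φ b ⧸ (tildeRange φ).submoduleOf (extrapFunctions φ b)))

/-- The class map as a linear map. -/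
def mkₗ : extrapFunctions φ b →ₗ[ℂ] ExtrapSpace φ b :=
  ((tildeRange φ).submoduleOf (extrapFunctions φ b)).mkQ

variable {φ b}

/-- The class `[x]` of a function `x`. -/
def mk (x : CPlus → U) (hx : x ∈ extrapFunctions φ b) : ExtrapSpace φ b :=
  mkₗ φ b ⟨x, hx⟩

lemma mk_surjective (ξ : ExtrapSpace φ b) :
    ∃ (x : CPlus → U) (hx : x ∈ extrapFunctions φ b), mk x hx = ξ := by
  obtain ⟨⟨x, hx⟩, h⟩ :=
    Submodule.mkQ_surjective ((tildeRange φ).submoduleOf (extrapFunctions φ b)) ξ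
  exact ⟨x, hx, h⟩

lemma mk_eq_mk_iff {x x' : CPlus → U} (hx : x ∈ extrapFunctions φ b)
    (hx' : x' ∈ extrapFunctions φ b) :
    (mk x hx = mk x' hx') ↔ ∃ y : Y, ∀ μ, x μ - x' μ = φ.tilde μ y := by
  have e : (mk x hx = mk x' hx') ↔
      (⟨x, hx⟩ - ⟨x', hx'⟩ : extrapFunctions φ b) ∈
        (tildeRange φ).submoduleOf (extrapFunctions φ b) :=
    Submodule.Quotient.eq _
  rw [e, Submodule.submoduleOf, Submodule.mem_comap, tildeRange, LinearMap.mem_range]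
  constructor
  · rintro ⟨y, hy⟩
    exact ⟨y, fun μ => (congrFun hy μ).symm⟩
  · rintro ⟨y, hy⟩
    exact ⟨y, funext fun μ => (hy μ).symm⟩

lemma mul_mem (h : StateSpace φ) :
    (fun μ : CPlus => ((b : ℂ) + (μ : ℂ)) • h μ) ∈ extrapFunctions φ b :=
  ⟨0, h, fun μ => by rw [map_zero, add_zero, inv_smul_smul₀ (add_coe_ne_zero b μ)]⟩

variable (φ b)

/-- The linear map `h ↦ [μ ↦ (b + μ) h(μ)]` of the state space onto the extrapolation space. -/
def ofState : StateSpace φ →ₗ[ℂ] ExtrapSpace φ b :=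
  mkₗ φ b ∘ₗ
    { toFun := fun h => ⟨fun μ : CPlus => ((b : ℂ) + (μ : ℂ)) • h μ, mul_mem h⟩
      map_add' := fun h h' => Subtype.ext (funext fun μ => by simp)
      map_smul' := fun c h => Subtype.ext (funext fun μ => by simp [smul_comm c]) }

variable {φ b}

lemma ofState_eq_mk_iff {x : CPlus → U} (hx : x ∈ extrapFunctions φ b) (h : StateSpace φ) :
    ofState φ b h = mk x hx ↔ ∃ y : Y, IsQuotientFor φ b x y h := by
  have e : ofState φ b h = mk _ (mul_mem h) := rfl
  rw [e, mk_eq_mk_iff]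
  refine exists_congr fun y => forall_congr' fun μ => ?_
  rw [eq_inv_smul_iff₀ (add_coe_ne_zero b μ), sub_eq_iff_eq_add, add_comm (x μ)]

lemma ofState_surjective : Function.Surjective (ofState φ b) := by
  intro ξ
  obtain ⟨x, hx, rfl⟩ := mk_surjective ξ
  obtain ⟨y, h, hh⟩ := id hx
  exact ⟨h, (ofState_eq_mk_iff hx h).mpr ⟨y, hh⟩⟩

variable (φ b)

/-- The identification of the extrapolation space with the quotient of the state space by the
kernel of `ofState`. -/
def toQuotient : ExtrapSpace φ b ≃ₗ[ℂ] StateSpace φ ⧸ LinearMap.ker (ofState φ b) :=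
  ((ofState φ b).quotKerEquivOfSurjective ofState_surjective).symm

/-- The norm of `[x]` is that of `μ ↦ (x(μ) + φ(conj μ)* y) / (b + μ)` in the state space. A priori
several functions of this form may lie in the state space, and then the infimum of their norms is
taken (this gives a seminorm); see `norm_mk`. -/
instance : SeminormedAddCommGroup (ExtrapSpace φ b) :=
  SeminormedAddCommGroup.induced (ExtrapSpace φ b)
    (StateSpace φ ⧸ LinearMap.ker (ofState φ b)) (toQuotient φ b)

instance : NormedSpace ℂ (ExtrapSpace φ b) :=
  NormedSpace.induced ℂ (ExtrapSpace φ b)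
    (StateSpace φ ⧸ LinearMap.ker (ofState φ b)) (toQuotient φ b)

variable {φ b}

lemma norm_mk (x : CPlus → U) (hx : x ∈ extrapFunctions φ b) :
    ‖mk x hx‖ = sInf {t : ℝ | ∃ (y : Y) (h : StateSpace φ), IsQuotientFor φ b x y h ∧ t = ‖h‖} := by
  have e : ‖mk x hx‖ = ‖toQuotient φ b (mk x hx)‖ := rfl
  have key : ∀ h : StateSpace φ,
      (Submodule.Quotient.mk h : StateSpace φ ⧸ LinearMap.ker (ofState φ b)) =
        toQuotient φ b (mk x hx) ↔ ∃ y : Y, IsQuotientFor φ b x y h := by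
    intro h
    rw [← ofState_eq_mk_iff hx h, toQuotient]
    exact LinearEquiv.eq_symm_apply _
  have hglb : IsGLB {t : ℝ | ∃ (y : Y) (h : StateSpace φ), IsQuotientFor φ b x y h ∧ t = ‖h‖}
      ‖mk x hx‖ := by
    rw [e]
    constructor
    · rintro _ ⟨y, h, hh, rfl⟩
      rw [← (key h).mpr ⟨y, hh⟩]
      exact Submodule.Quotient.norm_mk_le _ h
    · intro t ht
      refine le_of_forall_pos_le_add fun ε hε => ?_
      obtain ⟨h, hh, hlt⟩ := Submodule.Quotient.norm_mk_lt (toQuotient φ b (mk x hx)) hε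
      obtain ⟨y, hy⟩ := (key h).mp hh
      exact (ht ⟨y, h, hy, rfl⟩).trans hlt.le
  obtain ⟨y, h, hh⟩ := id hx
  exact (hglb.csInf_eq ⟨_, y, h, hh, rfl⟩).symm

end ExtrapSpace

/-! ### Extensions of the main operator and the control operator

Here `j : X → E` embeds the state space `X` into an extrapolation space `E`. -/

section Rigging

variable {X E V W : Type*} [NormedAddCommGroup X] [NormedSpace ℂ X]
  [SeminormedAddCommGroup E] [NormedSpace ℂ E]
  [NormedAddCommGroup V] [NormedSpace ℂ V] [NormedAddCommGroup W] [NormedSpace ℂ W]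

/-- `T : X → E` extends `A`, where `X` is identified with a subspace of `E` by `j`. -/
def IsExtensionOf (A : X →ₗ.[ℂ] X) (j T : X →L[ℂ] E) : Prop :=
  ∀ x : A.domain, T (x : X) = j (A x)

/-- `[T B]` extends `[A&B]`, where `X` is identified with a subspace of `E` by `j`. -/
def IsControlOperator (S : (X × V) →ₗ.[ℂ] (X × W)) (j T : X →L[ℂ] E) (B : V →L[ℂ] E) : Prop :=
  ∀ p : S.domain, j (S p).1 = T (p : X × V).1 + B (p : X × V).2

end Rigging

end ExtrapModel

end

open ExtrapModel

/-!
The graph `G` of the system node is the closed span of its generators, and the energy balance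
`‖u‖² - ‖y‖² = 2 Re ⟪z, x⟫` on it does all the work. Tested against the generators, its polarized
form says that every `((x, u), (z, y))` in `G` satisfies `z(μ) + μ x(μ) = u - φ(conj μ)* y`
(`nodeGraph_apply`). Written as
`‖a x - z‖² + 2 Re a ‖u‖² = ‖conj a x + z‖² + 2 Re a ‖y‖²`, it shows that the map
`((x, u), (z, y)) ↦ (a x - z, u)` is bounded below on `G`. Its range is therefore closed, and it is
dense because it contains all `(0, u)` and all `(K(·, μ) u, 0)` with `μ ≠ conj a`, hence by
continuity of the kernel all `(K(·, μ) u, 0)`. So that map is a bijection onto `H × U`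
(`stateEquation_bijective`); the `x`-component of its inverse is the operator `stateSolve φ a`,
which sends `(w, u)` to a function of the form `(w(μ) + u + φ(conj μ)* y) / (a + μ)`
(`stateSolve_quotient`). For `u = 0` it is the resolvent of the main operator. None of this depends
on the hypothesis on the functions `φ(conj μ)* y / (a₀ + μ)`.

By a resolvent identity, that hypothesis passes from `a₀` to every point of the half-plane
(`tilde_quotient_eq_zero`). Thus a function in the state space of the form
`(x(μ) + φ(conj μ)* y) / (b + μ)` is determined by `x` (`quotient_unique`), and the map
`h ↦ [(b + μ) h(μ)]` is a unitary operator from the state space onto the extrapolation space. All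
the operators in the theorem come from this unitary operator `W` and from `stateSolve φ b`: the
embedding is `W (b - A)⁻¹`, the extension of `A` is `b` times the embedding minus `W`, and the
control operator is `u ↦ W (stateSolve φ b (0, u))`. Uniqueness of the extension and density of the
embedding rest on the density of the domain of `A`, which holds because `A` is dissipative and
`b - A` is surjective (`mainResolvent_denseRange`).
-/

namespace ExtrapModel

variable {U Y : Type*}
    [NormedAddCommGroup U] [InnerProductSpace ℂ U] [CompleteSpace U]
    [NormedAddCommGroup Y] [InnerProductSpace ℂ Y] [CompleteSpace Y]

/-! ### The functional equation on the graph of the node -/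

lemma CPlus.conj_conj (μ : CPlus) : μ.conj.conj = μ := Subtype.ext (by simp [CPlus.conj])

lemma CPlus.continuous_conj : Continuous CPlus.conj :=
  (Complex.continuous_conj.comp continuous_subtype_val).subtype_mk _

lemma generator_mem (φ : SchurClass U Y) (μ : CPlus) (v : U) :
    ((kerVec φ μ v, v), ((μ.conj : ℂ) • kerVec φ μ v, φ.app μ.conj v)) ∈ nodeGraph φ := by
  apply Submodule.le_topologicalClosure
  apply Submodule.subset_span
  exact ⟨μ.conj, v, by rw [CPlus.conj_conj]⟩

/-- An element `((x, u), (z, y))` of the graph satisfies `z(μ) + μ x(μ) = u - φ(conj μ)* y`: this is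
the energy balance between it and the generators, read through the reproducing property. -/
lemma nodeGraph_apply (φ : SchurClass U Y) {x z : StateSpace φ} {u : U} {y : Y}
    (hp : ((x, u), (z, y)) ∈ nodeGraph φ) (μ : CPlus) :
    z μ + (μ : ℂ) • x μ = u - φ.tilde μ y := by
  refine ext_inner_right ℂ fun v => ?_
  have := nodeGraph_balance φ hp (generator_mem φ μ v)
  simp only [inner_smul_right, inner_kerVec] at this
  rw [inner_add_left, inner_sub_left, inner_smul_left, SchurClass.tilde,
    ContinuousLinearMap.adjoint_inner_left]
  exact this.symm

/-! ### Continuity of the kernel functions -/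

omit [CompleteSpace U] [CompleteSpace Y] in
lemma continuous_app (φ : SchurClass U Y) : Continuous φ.app :=
  continuousOn_iff_continuous_domRestrict.mp φ.holo.continuousOn

lemma continuous_kerVec_eval (φ : SchurClass U Y) (u : U) {f g : CPlus → CPlus}
    (hf : Continuous f) (hg : Continuous g) : Continuous fun μ => kerVec φ (f μ) u (g μ) := by
  have happ : Continuous fun μ : CPlus => φ.app μ.conj :=
    (continuous_app φ).comp CPlus.continuous_conj
  have htil : Continuous φ.tilde :=
    (ContinuousLinearMap.adjoint (𝕜 := ℂ) (E := U) (F := Y)).continuous.comp happ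
  have h1 : Continuous fun μ => φ.tilde (g μ) (φ.app (f μ).conj u) :=
    (htil.comp hg).clm_apply ((happ.comp hf).clm_apply continuous_const)
  have h2 : Continuous fun μ => ((g μ : ℂ) + starRingEnd ℂ (f μ : ℂ))⁻¹ := by
    refine Continuous.inv₀ (by fun_prop) fun μ => ?_
    exact add_coe_ne_zero (g μ) (f μ).conj
  simp only [kerVec_apply]
  exact h2.smul (continuous_const.sub h1)

/-- The kernel functions depend norm-continuously on the point, since
`‖K(·, μ) u - K(·, μ₀) u‖²` is a combination of values of the kernel. -/
lemma continuous_kerVec (φ : SchurClass U Y) (u : U) :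
    Continuous fun μ : CPlus => kerVec φ μ u := by
  rw [continuous_iff_continuousAt]
  intro μ₀
  rw [ContinuousAt, tendsto_iff_norm_sub_tendsto_zero]
  have e : ∀ μ : CPlus, ‖kerVec φ μ u - kerVec φ μ₀ u‖ ^ 2 =
      (inner ℂ (kerVec φ μ u μ - kerVec φ μ₀ u μ) u -
        inner ℂ (kerVec φ μ u μ₀ - kerVec φ μ₀ u μ₀) u : ℂ).re := by
    intro μ
    have := inner_self_eq_norm_sq (𝕜 := ℂ) (kerVec φ μ u - kerVec φ μ₀ u)
    rw [← this, inner_sub_right, inner_kerVec, inner_kerVec, RKHS.coe_sub, Pi.sub_apply,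
      Pi.sub_apply]
    rfl
  have h1 := continuous_kerVec_eval φ u continuous_id continuous_id
  have h2 := continuous_kerVec_eval φ u (continuous_const (y := μ₀)) continuous_id
  have h3 := continuous_kerVec_eval φ u continuous_id (continuous_const (y := μ₀))
  simp only [id_eq] at h1 h2 h3
  have hsq : Continuous fun μ : CPlus => ‖kerVec φ μ u - kerVec φ μ₀ u‖ ^ 2 := by
    simp only [e]
    exact Complex.continuous_re.comp (((h1.sub h2).inner continuous_const).sub
      ((h3.sub continuous_const).inner continuous_const))
  have h0 := (Real.continuous_sqrt.comp hsq).tendsto μ₀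
  simpa [Function.comp_def, Real.sqrt_sq] using h0

instance : ConnectedSpace CPlus :=
  Subtype.connectedSpace ⟨⟨1, show (0 : ℝ) < (1 : ℂ).re by norm_num⟩,
    (convex_halfSpace_re_gt 0).isPreconnected⟩

instance : Nontrivial CPlus :=
  ⟨⟨1, by norm_num⟩, ⟨2, by norm_num⟩, by simp⟩

/-! ### Solvability of the state equation -/

/-- The map `((x, u), (z, y)) ↦ (a x - z, u)` on the graph of the node. A preimage of `(w, u)` is a
solution of the state equation `a x = z + w` of the node with input `u`. -/
noncomputable def stateEquation (φ : SchurClass U Y) (a : CPlus) :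
    nodeGraph φ →L[ℂ] StateSpace φ × U :=
  (((a : ℂ) • ContinuousLinearMap.fst ℂ (StateSpace φ) U ∘L ContinuousLinearMap.fst ℂ _ _ -
      ContinuousLinearMap.fst ℂ (StateSpace φ) Y ∘L ContinuousLinearMap.snd ℂ _ _).prod
    (ContinuousLinearMap.snd ℂ (StateSpace φ) U ∘L ContinuousLinearMap.fst ℂ _ _)) ∘L
    (nodeGraph φ).subtypeL

lemma stateEquation_apply (φ : SchurClass U Y) (a : CPlus) (p : nodeGraph φ) :
    stateEquation φ a p = ((a : ℂ) • p.1.1.1 - p.1.2.1, p.1.1.2) := rfl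

/-- The energy balance in the form of a Cayley transform: `(a x - z, √(2 Re a) u)` and
`(conj a x + z, √(2 Re a) y)` have equal norms. -/
lemma nodeGraph_norm_balance (φ : SchurClass U Y) (a : ℂ) {x z : StateSpace φ} {u : U} {y : Y}
    (hp : ((x, u), (z, y)) ∈ nodeGraph φ) :
    ‖a • x - z‖ ^ 2 + 2 * a.re * ‖u‖ ^ 2 = ‖conj a • x + z‖ ^ 2 + 2 * a.re * ‖y‖ ^ 2 := by
  have h := congrArg Complex.re (nodeGraph_balance φ hp hp)
  have h1 : (inner ℂ u u : ℂ).re = ‖u‖ ^ 2 := inner_self_eq_norm_sq (𝕜 := ℂ) u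
  have h2 : (inner ℂ y y : ℂ).re = ‖y‖ ^ 2 := inner_self_eq_norm_sq (𝕜 := ℂ) y
  have h3 : (inner ℂ z x : ℂ).re = (inner ℂ x z : ℂ).re := inner_re_symm (𝕜 := ℂ) z x
  have h4 := norm_sub_sq (𝕜 := ℂ) (a • x) z
  have h5 := norm_add_sq (𝕜 := ℂ) (conj a • x) z
  simp only [Complex.sub_re, Complex.add_re, h1, h2, h3] at h
  simp only [inner_smul_left, norm_smul, RCLike.re_to_complex, Complex.mul_re, Complex.conj_re,
    Complex.conj_im, Complex.conj_conj, RCLike.norm_conj] at h4 h5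
  rw [h4, h5]
  linear_combination 2 * a.re * h

/-- The map `stateEquation φ a` is bounded below: `nodeGraph_norm_balance` bounds `conj a x + z` and
`y`, and `2 Re a • x` is the sum of `a x - z` and `conj a x + z`. -/
lemma stateEquation_bound (φ : SchurClass U Y) (a : CPlus) :
    ∃ C : NNReal, ∀ p : nodeGraph φ, ‖p‖ ≤ C * ‖stateEquation φ a p‖ := by
  have ha := a.2
  set r := (a : ℂ).re
  set k := Real.sqrt (1 + 2 * r)
  set m := (1 + k) / (2 * r)
  set l := Real.sqrt ((1 + 2 * r) / (2 * r))
  have hk : 0 ≤ k := Real.sqrt_nonneg _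
  have hl : 0 ≤ l := Real.sqrt_nonneg _
  have hm : 0 ≤ m := by positivity
  have hk2 : k ^ 2 = 1 + 2 * r := Real.sq_sqrt (by positivity)
  have hl2 : l ^ 2 = (1 + 2 * r) / (2 * r) := Real.sq_sqrt (by positivity)
  refine ⟨⟨m + 1 + (‖(a : ℂ)‖ * m + 1) + l, by positivity⟩, ?_⟩
  rintro ⟨⟨⟨x, u⟩, ⟨z, y⟩⟩, hp⟩
  have hb := nodeGraph_norm_balance φ a hp
  rw [stateEquation_apply]
  set N := ‖(((a : ℂ) • x - z, u) : StateSpace φ × U)‖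
  have hN0 : 0 ≤ N := norm_nonneg _
  have n1 : ‖(a : ℂ) • x - z‖ ≤ N := norm_fst_le ((a : ℂ) • x - z, u)
  have n2 : ‖u‖ ≤ N := norm_snd_le ((a : ℂ) • x - z, u)
  have n1' : ‖(a : ℂ) • x - z‖ ^ 2 ≤ N ^ 2 := by gcongr
  have n2' : 2 * r * ‖u‖ ^ 2 ≤ 2 * r * N ^ 2 := by gcongr
  have n3 : ‖conj (a : ℂ) • x + z‖ ≤ k * N := by
    refine le_of_sq_le_sq ?_ (by positivity)
    rw [mul_pow, hk2]
    nlinarith [mul_nonneg ha.le (sq_nonneg ‖y‖)]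
  have n4 : ‖y‖ ≤ l * N := by
    refine le_of_sq_le_sq ?_ (by positivity)
    rw [mul_pow, hl2, div_mul_eq_mul_div, le_div_iff₀ (by positivity)]
    nlinarith [sq_nonneg ‖conj (a : ℂ) • x + z‖]
  have n5 : ‖x‖ ≤ m * N := by
    have e : ((2 * r : ℝ) : ℂ) • x = ((a : ℂ) • x - z) + (conj (a : ℂ) • x + z) := by
      have : ((2 * r : ℝ) : ℂ) = a + conj (a : ℂ) := by
        rw [Complex.add_conj]
      rw [this, add_smul]; abel
    have := norm_add_le ((a : ℂ) • x - z) (conj (a : ℂ) • x + z)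
    rw [← e, norm_smul, Complex.norm_real, Real.norm_of_nonneg (by positivity)] at this
    rw [div_mul_eq_mul_div, le_div_iff₀ (by positivity)]
    linarith
  have n6 : ‖z‖ ≤ (‖(a : ℂ)‖ * m + 1) * N := by
    have e : z = (a : ℂ) • x - ((a : ℂ) • x - z) := by abel
    have := norm_sub_le ((a : ℂ) • x) ((a : ℂ) • x - z)
    rw [← e, norm_smul] at this
    nlinarith [mul_le_mul_of_nonneg_left n5 (norm_nonneg (a : ℂ))]
  have hm' : 0 ≤ m * N := by positivity
  have hl' : 0 ≤ l * N := by positivity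
  have hz' : 0 ≤ (‖(a : ℂ)‖ * m + 1) * N := by positivity
  change max (max ‖x‖ ‖u‖) (max ‖z‖ ‖y‖) ≤ (m + 1 + (‖(a : ℂ)‖ * m + 1) + l) * N
  simp only [add_mul, one_mul] at *
  refine max_le (max_le ?_ ?_) (max_le ?_ ?_) <;> linarith

/-- The state equation is uniquely solvable on the graph of the node. The range is closed since the map
is bounded below, and dense since it contains all pairs `(0, u)` and `(K(·, μ) u, 0)`. -/
lemma stateEquation_bijective (φ : SchurClass U Y) (a : CPlus) :
    (stateEquation φ a).toLinearMap.ker = ⊥ ∧ (stateEquation φ a).toLinearMap.range = ⊤ := by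
  obtain ⟨C, hC⟩ := stateEquation_bound φ a
  have hanti := (stateEquation φ a).antilipschitz_of_bound hC
  have hG : IsClosed (nodeGraph φ : Set ((StateSpace φ × U) × (StateSpace φ × Y))) :=
    Submodule.isClosed_topologicalClosure _
  have : CompleteSpace (nodeGraph φ) := hG.completeSpace_coe
  have hcl : IsClosed ((stateEquation φ a).toLinearMap.range : Set (StateSpace φ × U)) := by
    have := hanti.isClosed_range (stateEquation φ a).uniformContinuous
    rw [LinearMap.coe_range]
    exact this
  refine ⟨LinearMap.ker_eq_bot.mpr hanti.injective, ?_⟩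
  set M := (stateEquation φ a).toLinearMap.range
  have hgen : ∀ (μ : CPlus) (u : U), (((a : ℂ) - μ.conj) • kerVec φ μ u, u) ∈ M := by
    intro μ u
    refine ⟨⟨_, generator_mem φ μ u⟩, ?_⟩
    change stateEquation φ a _ = _
    rw [stateEquation_apply]
    simp [sub_smul]
  have hU : ∀ u : U, ((0, u) : StateSpace φ × U) ∈ M := by
    intro u
    -- the coefficient of the kernel function vanishes at `conj a`
    simpa [CPlus.conj_conj] using hgen a.conj u
  have hker : ∀ (μ : CPlus) (u : U), ((kerVec φ μ u, 0) : StateSpace φ × U) ∈ M := by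
    intro μ u
    have hd : Dense ({a.conj}ᶜ : Set CPlus) := dense_compl_singleton _
    have hc : IsClosed {μ : CPlus | ((kerVec φ μ u, 0) : StateSpace φ × U) ∈ M} :=
      hcl.preimage ((continuous_kerVec φ u).prodMk continuous_const)
    have hsub : ({a.conj}ᶜ : Set CPlus) ⊆
        {μ : CPlus | ((kerVec φ μ u, 0) : StateSpace φ × U) ∈ M} := by
      intro μ hμ
      have hne : (a : ℂ) - μ.conj ≠ 0 := by
        intro h
        apply hμ
        have : a = μ.conj := Subtype.ext (sub_eq_zero.mp h)
        simp [this, CPlus.conj_conj]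
      have := M.smul_mem ((a : ℂ) - μ.conj)⁻¹ (M.sub_mem (hgen μ u) (hU u))
      simpa [hne] using this
    exact hc.closure_subset_iff.mpr hsub (hd μ)
  have hX : ∀ x : StateSpace φ, ((x, 0) : StateSpace φ × U) ∈ M := by
    intro x
    have hx : x ∈ Submodule.topologicalClosure (Submodule.span ℂ
        {RKHS.kerFun (StateSpace φ) μ v | (μ : CPlus) (v : U)}) := by
      rw [RKHS.kerFun_dense]; trivial
    have hc : IsClosed ((M.comap (LinearMap.inl ℂ (StateSpace φ) U) : Submodule ℂ (StateSpace φ)) :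
        Set (StateSpace φ)) :=
      hcl.preimage (continuous_id.prodMk continuous_const)
    refine Submodule.topologicalClosure_minimal _ ?_ hc hx
    rw [Submodule.span_le]
    rintro _ ⟨μ, v, rfl⟩
    exact hker μ v
  rw [Submodule.eq_top_iff']
  rintro ⟨x, u⟩
  simpa using M.add_mem (hX x) (hU u)

theorem exists_stateSolve (φ : SchurClass U Y) (a : CPlus) :
    ∃ E : StateSpace φ × U →L[ℂ] StateSpace φ,
      (∀ w u, ∃ z y, ((E (w, u), u), (z, y)) ∈ nodeGraph φ ∧ (a : ℂ) • E (w, u) - z = w) ∧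
      ∀ x u z y, ((x, u), (z, y)) ∈ nodeGraph φ → E ((a : ℂ) • x - z, u) = x := by
  obtain ⟨hk, hr⟩ := stateEquation_bijective φ a
  have hG : IsClosed (nodeGraph φ : Set ((StateSpace φ × U) × (StateSpace φ × Y))) :=
    Submodule.isClosed_topologicalClosure _
  have : CompleteSpace (nodeGraph φ) := hG.completeSpace_coe
  let e := ContinuousLinearEquiv.ofBijective (stateEquation φ a) hk hr
  have he : ∀ p, e p = stateEquation φ a p := fun p => rfl
  refine ⟨ContinuousLinearMap.fst ℂ _ _ ∘L ContinuousLinearMap.fst ℂ _ _ ∘L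
    (nodeGraph φ).subtypeL ∘L (e.symm : StateSpace φ × U →L[ℂ] nodeGraph φ), ?_, ?_⟩
  · intro w u
    have h := e.apply_symm_apply (w, u)
    rw [he, stateEquation_apply, Prod.mk.injEq] at h
    refine ⟨(e.symm (w, u)).1.2.1, (e.symm (w, u)).1.2.2, ?_, h.1⟩
    convert! (e.symm (w, u)).2 using 1
    ext : 2
    · rfl
    · exact h.2.symm
    · rfl
    · rfl
  · intro x u z y hp
    have h : e.symm ((a : ℂ) • x - z, u) = ⟨_, hp⟩ := by
      rw [ContinuousLinearEquiv.symm_apply_eq, he, stateEquation_apply]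
    change (e.symm ((a : ℂ) • x - z, u)).1.1.1 = x
    rw [h]

/-- The operator `(w, u) ↦ x`, where `((x, u), (z, y))` is the element of the graph of the node with
`a x - z = w`. For `u = 0` it is the resolvent of the main operator at `a`. -/
noncomputable def stateSolve (φ : SchurClass U Y) (a : CPlus) :
    StateSpace φ × U →L[ℂ] StateSpace φ :=
  (exists_stateSolve φ a).choose

lemma stateSolve_spec (φ : SchurClass U Y) (a : CPlus) (w : StateSpace φ) (u : U) :
    ∃ z y, ((stateSolve φ a (w, u), u), (z, y)) ∈ nodeGraph φ ∧
      (a : ℂ) • stateSolve φ a (w, u) - z = w :=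
  (exists_stateSolve φ a).choose_spec.1 w u

lemma stateSolve_of_mem (φ : SchurClass U Y) (a : CPlus) {x z : StateSpace φ} {u : U} {y : Y}
    (hp : ((x, u), (z, y)) ∈ nodeGraph φ) : stateSolve φ a ((a : ℂ) • x - z, u) = x :=
  (exists_stateSolve φ a).choose_spec.2 x u z y hp

lemma isQuotientFor_iff (φ : SchurClass U Y) (a : CPlus) (x : CPlus → U) (y : Y)
    (h : StateSpace φ) :
    IsQuotientFor φ a x y h ↔ ∀ μ : CPlus, ((a : ℂ) + (μ : ℂ)) • h μ = x μ + φ.tilde μ y :=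
  forall_congr' fun μ => eq_inv_smul_iff₀ (add_coe_ne_zero a μ)

/-- The functional equation of `nodeGraph_apply`, solved for the state. -/
lemma stateSolve_quotient (φ : SchurClass U Y) (a : CPlus) (w : StateSpace φ) (u : U) :
    ∃ y, IsQuotientFor φ a (fun μ => w μ + u) y (stateSolve φ a (w, u)) := by
  obtain ⟨z, y, hp, hz⟩ := stateSolve_spec φ a w u
  refine ⟨-y, (isQuotientFor_iff ..).mpr fun μ => ?_⟩
  have h1 := nodeGraph_apply φ hp μ
  have h2 : (a : ℂ) • stateSolve φ a (w, u) μ - z μ = w μ := by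
    have := congrArg (fun f : StateSpace φ => f μ) hz
    simpa using this
  rw [map_neg, add_smul, ← h2, ← sub_eq_zero]
  rw [← sub_eq_zero] at h1
  rw [← h1]
  abel

/-! ### The node, its main operator and the resolvent -/

lemma mem_node_domain (φ : SchurClass U Y) (x : StateSpace φ) (u : U) :
    (x, u) ∈ (node φ).domain ↔ ∃ z y, ((x, u), (z, y)) ∈ nodeGraph φ := by
  rw [← node_graph, LinearPMap.mem_domain_iff]
  exact Prod.exists

lemma node_mem_graph (φ : SchurClass U Y) (p : (node φ).domain) :
    ((p : StateSpace φ × U), node φ p) ∈ nodeGraph φ := by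
  rw [← node_graph]
  exact LinearPMap.mem_graph _ p

lemma mem_mainOperator_domain (φ : SchurClass U Y) (x : StateSpace φ) :
    x ∈ (mainOperator (node φ)).domain ↔ ∃ z y, ((x, (0 : U)), (z, y)) ∈ nodeGraph φ :=
  mem_node_domain φ x 0

lemma mainOperator_mem_graph (φ : SchurClass U Y) (x : (mainOperator (node φ)).domain) :
    ∃ y, (((x : StateSpace φ), (0 : U)), (mainOperator (node φ) x, y)) ∈ nodeGraph φ :=
  ⟨_, node_mem_graph φ ⟨((x : StateSpace φ), 0), x.2⟩⟩

lemma nodeGraph_unique (φ : SchurClass U Y) {p : StateSpace φ × U} {q q' : StateSpace φ × Y}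
    (h : (p, q) ∈ nodeGraph φ) (h' : (p, q') ∈ nodeGraph φ) : q = q' := by
  rw [← node_graph] at h h'
  exact LinearPMap.mem_graph_snd_inj _ h h' rfl

lemma mainOperator_eq (φ : SchurClass U Y) (x : (mainOperator (node φ)).domain)
    {z : StateSpace φ} {y : Y} (hp : (((x : StateSpace φ), (0 : U)), (z, y)) ∈ nodeGraph φ) :
    mainOperator (node φ) x = z := by
  obtain ⟨y', h⟩ := mainOperator_mem_graph φ x
  exact congrArg Prod.fst (nodeGraph_unique φ h hp)

/-- The resolvent `(a - A)⁻¹` of the main operator. -/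
noncomputable def mainResolvent (φ : SchurClass U Y) (a : CPlus) :
    StateSpace φ →L[ℂ] StateSpace φ :=
  stateSolve φ a ∘L ContinuousLinearMap.inl ℂ (StateSpace φ) U

lemma mainResolvent_apply (φ : SchurClass U Y) (a : CPlus) (w : StateSpace φ) :
    mainResolvent φ a w = stateSolve φ a (w, 0) := rfl

lemma mainResolvent_isResolventAt (φ : SchurClass U Y) (a : CPlus) :
    IsResolventAt (mainOperator (node φ)) (a : ℂ) (mainResolvent φ a) := by
  constructor
  · intro x
    obtain ⟨z, y, hp, hz⟩ := stateSolve_spec φ a x 0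
    refine ⟨⟨mainResolvent φ a x, (mem_mainOperator_domain φ _).mpr ⟨z, y, hp⟩⟩, rfl, ?_⟩
    rw [mainOperator_eq φ _ hp]
    exact hz
  · intro z
    obtain ⟨y, hp⟩ := mainOperator_mem_graph φ z
    exact stateSolve_of_mem φ a hp

lemma mainResolvent_mem_domain (φ : SchurClass U Y) (a : CPlus) (w : StateSpace φ) :
    mainResolvent φ a w ∈ (mainOperator (node φ)).domain := by
  obtain ⟨z, y, hp, -⟩ := stateSolve_spec φ a w 0
  exact (mem_mainOperator_domain φ _).mpr ⟨z, y, hp⟩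

lemma mainResolvent_injective (φ : SchurClass U Y) (a : CPlus) :
    Function.Injective (mainResolvent φ a) := by
  refine (injective_iff_map_eq_zero _).mpr fun x hx => ?_
  obtain ⟨z, hz, h⟩ := (mainResolvent_isResolventAt φ a).1 x
  rw [hx] at hz
  have : z = 0 := Subtype.ext hz
  rw [← h, this]
  simp

lemma mainResolvent_quotient (φ : SchurClass U Y) (a : CPlus) (w : StateSpace φ) :
    ∃ y, IsQuotientFor φ a w y (mainResolvent φ a w) := by
  simpa [mainResolvent_apply] using stateSolve_quotient φ a w 0

lemma mainOperator_apply (φ : SchurClass U Y) (x : (mainOperator (node φ)).domain) :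
    ∃ y, ∀ μ : CPlus,
      mainOperator (node φ) x μ = -((μ : ℂ) • (x : StateSpace φ) μ) + φ.tilde μ y := by
  obtain ⟨y, hp⟩ := mainOperator_mem_graph φ x
  refine ⟨-y, fun μ => ?_⟩
  have := nodeGraph_apply φ hp μ
  rw [zero_sub] at this
  rw [map_neg, ← this]
  abel

/-- The domain of the main operator is dense: if `f` is orthogonal to it and `x = (a - A)⁻¹ f`, then
`0 = Re ⟪x, f⟫ ≥ Re a ‖x‖²` by dissipativity of `A`, so that `f = 0`. -/
lemma mainResolvent_denseRange (φ : SchurClass U Y) (a : CPlus) :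
    DenseRange (mainResolvent φ a) := by
  have key : (LinearMap.range (mainResolvent φ a : StateSpace φ →ₗ[ℂ] StateSpace φ))ᗮ = ⊥ := by
    rw [Submodule.eq_bot_iff]
    intro f hf
    have h0 : (inner ℂ (mainResolvent φ a f) f : ℂ) = 0 :=
      Submodule.inner_right_of_mem_orthogonal (LinearMap.mem_range_self _ f) hf
    obtain ⟨z, y, hp, hz⟩ := stateSolve_spec φ a f 0
    rw [← mainResolvent_apply] at hp hz
    set x := mainResolvent φ a f
    have hb := congrArg Complex.re (nodeGraph_balance φ hp hp)
    rw [← hz, inner_sub_right, inner_smul_right] at h0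
    have h0' := congrArg Complex.re h0
    have h1 : (inner ℂ x x : ℂ) = ((‖x‖ ^ 2 : ℝ) : ℂ) := by
      simp
    have h2 : (inner ℂ y y : ℂ).re = ‖y‖ ^ 2 := inner_self_eq_norm_sq (𝕜 := ℂ) y
    have h3 : (inner ℂ z x : ℂ).re = (inner ℂ x z : ℂ).re := inner_re_symm (𝕜 := ℂ) z x
    simp only [Complex.sub_re, Complex.add_re, h2, h3, inner_zero_left, Complex.zero_re] at hb
    rw [h1, Complex.sub_re, Complex.re_mul_ofReal, Complex.zero_re] at h0'
    have hx : ‖x‖ ^ 2 = 0 := by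
      have ha := a.2
      have : (a : ℂ).re * ‖x‖ ^ 2 ≤ 0 := by nlinarith [sq_nonneg ‖y‖]
      nlinarith [sq_nonneg ‖x‖]
    have hx0 : x = 0 := by simpa using hx
    exact mainResolvent_injective φ a (by rw [map_zero]; exact hx0)
  have := Submodule.dense_iff_topologicalClosure_eq_top.mpr
    (Submodule.topologicalClosure_eq_top_iff.mpr key)
  simpa [DenseRange, LinearMap.coe_range] using this

/-! ### Uniqueness of the quotients -/

/-- If the state space contains no nonzero function `φ(conj μ)* y / (a₀ + μ)`, then the same holds
with any other point `a` of the half-plane in place of `a₀`. For such a function `h` at `a`, the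
function `h - (a₀ - a)(a₀ - A)⁻¹ h` is one at `a₀`, hence zero. So `h` is an eigenvector of `A` for
the eigenvalue `a`, which lies in the resolvent set of `A`. -/
theorem tilde_quotient_eq_zero (φ : SchurClass U Y) {a₀ : CPlus}
    (hcond : ∀ (y : Y) (h : StateSpace φ), IsQuotientFor φ a₀ 0 y h → h = 0)
    (a : CPlus) {y : Y} {h : StateSpace φ} (hh : IsQuotientFor φ a 0 y h) : h = 0 := by
  obtain ⟨y', hy'⟩ := mainResolvent_quotient φ a₀ h
  set r := mainResolvent φ a₀ h
  set c : ℂ := (a₀ : ℂ) - a with hc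
  have h1 : h - c • r = 0 := by
    refine hcond (y - c • y') _ ((isQuotientFor_iff ..).mpr fun μ => ?_)
    have e1 := (isQuotientFor_iff ..).mp hy' μ
    have e2 := (isQuotientFor_iff ..).mp hh μ
    simp only [RKHS.coe_sub, RKHS.coe_smul, Pi.sub_apply, Pi.smul_apply, Pi.zero_apply, zero_add,
      map_sub, map_smul] at e2 ⊢
    rw [← e2, smul_sub, smul_comm _ c, e1, hc]
    module
  have hhr : h = c • r := sub_eq_zero.mp h1
  obtain ⟨z, hz, hz'⟩ := (mainResolvent_isResolventAt φ a₀).1 h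
  have hz2 : (z : StateSpace φ) = r := hz
  -- `h = (a₀ - a) z` is an eigenvector: `a z - A z = 0`
  have e3 : (a : ℂ) • (z : StateSpace φ) - mainOperator (node φ) z = 0 := by
    have : h = c • (z : StateSpace φ) := by rw [hz2]; exact hhr
    rw [this, hc] at hz'
    have e : mainOperator (node φ) z =
        (a₀ : ℂ) • (z : StateSpace φ) - ((a₀ : ℂ) - a) • (z : StateSpace φ) := by
      rw [← hz']; abel
    rw [e]; module
  have := (mainResolvent_isResolventAt φ a).2 z
  rw [e3, map_zero] at this
  rw [hhr, ← hz2, ← this, smul_zero]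

theorem quotient_unique (φ : SchurClass U Y) {a₀ : CPlus}
    (hcond : ∀ (y : Y) (h : StateSpace φ), IsQuotientFor φ a₀ 0 y h → h = 0)
    {a : CPlus} {x : CPlus → U} {y y' : Y} {h h' : StateSpace φ}
    (hh : IsQuotientFor φ a x y h) (hh' : IsQuotientFor φ a x y' h') : h = h' := by
  refine sub_eq_zero.mp (tilde_quotient_eq_zero φ hcond a (y := y - y') fun μ => ?_)
  rw [RKHS.coe_sub, Pi.sub_apply, hh μ, hh' μ, ← smul_sub, map_sub]
  congr 1
  simp

theorem tilde_eq_of_quotient (φ : SchurClass U Y) {a : CPlus} {x : CPlus → U} {y y' : Y}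
    {h : StateSpace φ} (hh : IsQuotientFor φ a x y h) (hh' : IsQuotientFor φ a x y' h)
    (μ : CPlus) : φ.tilde μ y = φ.tilde μ y' := by
  have e := (isQuotientFor_iff ..).mp hh μ
  rw [(isQuotientFor_iff ..).mp hh' μ] at e
  exact (add_left_cancel e).symm

/-! ### The extrapolation space as a unitary copy of the state space -/

namespace ExtrapSpace

variable {φ : SchurClass U Y} {b : CPlus}

lemma norm_mk_eq {a₀ : CPlus}
    (hcond : ∀ (y : Y) (h : StateSpace φ), IsQuotientFor φ a₀ 0 y h → h = 0)
    {x : CPlus → U} (hx : x ∈ extrapFunctions φ b) {y : Y} {h : StateSpace φ}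
    (hh : IsQuotientFor φ b x y h) : ‖mk x hx‖ = ‖h‖ := by
  rw [norm_mk]
  have : {t : ℝ | ∃ (y : Y) (h : StateSpace φ), IsQuotientFor φ b x y h ∧ t = ‖h‖} = {‖h‖} := by
    ext t
    constructor
    · rintro ⟨y', h', hh', rfl⟩
      rw [quotient_unique φ hcond hh hh']
      rfl
    · rintro rfl
      exact ⟨y, h, hh, rfl⟩
  rw [this, csInf_singleton]

lemma quotient_of_mul (h : StateSpace φ) :
    IsQuotientFor φ b (fun μ : CPlus => ((b : ℂ) + (μ : ℂ)) • h μ) 0 h :=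
  (isQuotientFor_iff ..).mpr fun μ => by simp

lemma norm_ofState {a₀ : CPlus}
    (hcond : ∀ (y : Y) (h : StateSpace φ), IsQuotientFor φ a₀ 0 y h → h = 0)
    (h : StateSpace φ) : ‖ofState φ b h‖ = ‖h‖ :=
  norm_mk_eq hcond (mul_mem h) (quotient_of_mul h)

lemma ofState_injective {a₀ : CPlus}
    (hcond : ∀ (y : Y) (h : StateSpace φ), IsQuotientFor φ a₀ 0 y h → h = 0) :
    Function.Injective (ofState φ b) := by
  refine (injective_iff_map_eq_zero _).mpr fun h h0 => ?_
  rw [← norm_eq_zero, ← norm_ofState (b := b) hcond, h0, norm_zero]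

/-- The unitary operator `h ↦ [μ ↦ (b + μ) h(μ)]` of the state space onto the extrapolation
space. -/
noncomputable def stateEquiv {a₀ : CPlus}
    (hcond : ∀ (y : Y) (h : StateSpace φ), IsQuotientFor φ a₀ 0 y h → h = 0) :
    StateSpace φ ≃ₗᵢ[ℂ] ExtrapSpace φ b where
  toLinearEquiv := LinearEquiv.ofBijective (ofState φ b)
    ⟨ofState_injective hcond, ofState_surjective⟩
  norm_map' := norm_ofState hcond

/-! ### The embedding, the extended main operator and the control operator -/

variable (φ b) in
/-- The contraction `h ↦ [μ ↦ (b + μ) h(μ)]` as a continuous linear map. -/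
noncomputable def ofStateL : StateSpace φ →L[ℂ] ExtrapSpace φ b :=
  (ofState φ b).mkContinuous 1 fun h => by
    rw [one_mul]
    refine (norm_mk (φ := φ) (b := b) _ (mul_mem h)).trans_le ?_
    refine csInf_le ⟨0, ?_⟩ ⟨0, h, quotient_of_mul h, rfl⟩
    rintro _ ⟨_, h', _, rfl⟩
    exact norm_nonneg h'

variable (φ b) in
/-- The embedding `x ↦ [x]` of the state space, defined as `ofState` after the resolvent at `b`; it
is the class map by `embedding_eq_mk`. -/
noncomputable def embedding : StateSpace φ →L[ℂ] ExtrapSpace φ b :=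
  ofStateL φ b ∘L mainResolvent φ b

variable (φ b) in
/-- The extension `x ↦ [μ ↦ -μ x(μ)]` of the main operator, defined as `b` times the embedding minus
`ofState`; the formula is `extendedMain_eq_mk`. -/
noncomputable def extendedMain : StateSpace φ →L[ℂ] ExtrapSpace φ b :=
  (b : ℂ) • embedding φ b - ofStateL φ b

lemma extendedMain_apply (x : StateSpace φ) :
    extendedMain φ b x = (b : ℂ) • embedding φ b x - ofState φ b x := rfl

variable (φ b) in
/-- The control operator `u ↦ [μ ↦ u]`, defined through `stateSolve`, which makes it continuous; the
formula is `control_eq_mk`. -/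
noncomputable def control : U →L[ℂ] ExtrapSpace φ b :=
  ofStateL φ b ∘L stateSolve φ b ∘L ContinuousLinearMap.inr ℂ (StateSpace φ) U

lemma coe_mem (x : StateSpace φ) : ⇑x ∈ extrapFunctions φ b :=
  (mainResolvent_quotient φ b x).imp fun _ h => ⟨_, h⟩

lemma embedding_eq_mk (x : StateSpace φ) : embedding φ b x = mk ⇑x (coe_mem x) :=
  (ofState_eq_mk_iff _ _).mpr (mainResolvent_quotient φ b x)

lemma neg_mul_mem (x : StateSpace φ) :
    (fun μ : CPlus => -((μ : ℂ) • x μ)) ∈ extrapFunctions φ b := by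
  convert! Submodule.sub_mem _ (Submodule.smul_mem _ (b : ℂ) (coe_mem (b := b) x))
    (mul_mem (b := b) x) using 1
  ext μ
  simp [add_smul]

lemma extendedMain_eq_mk (x : StateSpace φ) :
    extendedMain φ b x = mk (fun μ : CPlus => -((μ : ℂ) • x μ)) (neg_mul_mem x) := by
  rw [extendedMain_apply, embedding_eq_mk]
  refine (mk_eq_mk_iff (Submodule.sub_mem _ (Submodule.smul_mem _ (b : ℂ) (coe_mem (b := b) x))
    (mul_mem (b := b) x)) (neg_mul_mem x)).mpr ⟨0, fun μ => ?_⟩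
  simp [add_smul]

lemma const_mem (u : U) : (fun _ : CPlus => u) ∈ extrapFunctions φ b := by
  obtain ⟨y, hy⟩ := stateSolve_quotient φ b 0 u
  exact ⟨y, _, by simpa using hy⟩

lemma control_eq_mk (u : U) : control φ b u = mk (fun _ : CPlus => u) (const_mem u) := by
  refine (ofState_eq_mk_iff _ _).mpr ?_
  simpa using stateSolve_quotient φ b 0 u

lemma extendedMain_add_control (x : StateSpace φ) (u : U) :
    extendedMain φ b x + control φ b u = mk (fun μ : CPlus => -((μ : ℂ) • x μ) + u)
      (Submodule.add_mem _ (neg_mul_mem x) (const_mem u)) := by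
  rw [extendedMain_eq_mk, control_eq_mk]
  rfl

lemma embedding_eq_of_mem {x z : StateSpace φ} {u : U} {y : Y}
    (hp : ((x, u), (z, y)) ∈ nodeGraph φ) :
    embedding φ b z = extendedMain φ b x + control φ b u := by
  rw [extendedMain_add_control, embedding_eq_mk, mk_eq_mk_iff]
  refine ⟨-y, fun μ => ?_⟩
  have := nodeGraph_apply φ hp μ
  rw [eq_sub_iff_add_eq.mpr this]
  rw [map_neg]
  abel

/-! ### Extension, uniqueness and the range of the embedding -/

lemma isExtensionOf_extendedMain :
    IsExtensionOf (mainOperator (node φ)) (embedding φ b) (extendedMain φ b) := by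
  intro x
  obtain ⟨y, hp⟩ := mainOperator_mem_graph φ x
  rw [embedding_eq_of_mem hp, map_zero, add_zero]

lemma isControlOperator_control :
    IsControlOperator (node φ) (embedding φ b) (extendedMain φ b) (control φ b) :=
  fun p => embedding_eq_of_mem (node_mem_graph φ p)

/-- Every `u` is the second component of an element of the domain of the node, so the value at `u`
of a control operator is forced. -/
lemma control_unique {B : U →L[ℂ] ExtrapSpace φ b}
    (hB : IsControlOperator (node φ) (embedding φ b) (extendedMain φ b) B) :
    B = control φ b := by
  ext u
  obtain ⟨z, y, hp, -⟩ := stateSolve_spec φ b 0 u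
  have hd := (mem_node_domain φ _ u).mpr ⟨z, y, hp⟩
  have h := hB ⟨_, hd⟩
  rw [isControlOperator_control ⟨_, hd⟩] at h
  exact (add_left_cancel h).symm

lemma extension_unique (hdef : ∀ ξ : ExtrapSpace φ b, ‖ξ‖ = 0 → ξ = 0)
    {T : StateSpace φ →L[ℂ] ExtrapSpace φ b}
    (hT : IsExtensionOf (mainOperator (node φ)) (embedding φ b) T) :
    T = extendedMain φ b := by
  have h : ∀ x, ‖T x - extendedMain φ b x‖ = 0 := by
    refine fun x => (mainResolvent_denseRange φ b).induction_on x
      (isClosed_eq (by fun_prop) continuous_const) fun w => ?_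
    have hd := mainResolvent_mem_domain φ b w
    rw [hT ⟨_, hd⟩, isExtensionOf_extendedMain ⟨_, hd⟩, sub_self, norm_zero]
  ext x
  exact sub_eq_zero.mp (hdef _ (h x))

lemma exists_quotient_of_range {z : CPlus → U} (hz : z ∈ extrapFunctions φ b) {x : StateSpace φ}
    (hx : embedding φ b x = mk z hz) (a : CPlus) :
    ∃ y : Y, ∃ g ∈ (mainOperator (node φ)).domain, IsQuotientFor φ a z y g := by
  rw [embedding_eq_mk, mk_eq_mk_iff] at hx
  obtain ⟨γ, hγ⟩ := hx
  obtain ⟨y, hy⟩ := mainResolvent_quotient φ a x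
  refine ⟨y + γ, _, mainResolvent_mem_domain φ a x, fun μ => ?_⟩
  rw [hy μ, eq_add_of_sub_eq (hγ μ), map_add]
  congr 1
  abel

lemma range_of_exists_quotient {z : CPlus → U} (hz : z ∈ extrapFunctions φ b) {a : CPlus} {y : Y}
    {g : StateSpace φ} (hg : g ∈ (mainOperator (node φ)).domain) (h : IsQuotientFor φ a z y g) :
    ∃ x : StateSpace φ, embedding φ b x = mk z hz := by
  obtain ⟨y', hy'⟩ := mainOperator_apply φ ⟨g, hg⟩
  refine ⟨(a : ℂ) • g - mainOperator (node φ) ⟨g, hg⟩, ?_⟩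
  rw [embedding_eq_mk, mk_eq_mk_iff]
  refine ⟨y - y', fun μ => ?_⟩
  have e := (isQuotientFor_iff ..).mp h μ
  simp only [RKHS.coe_sub, RKHS.coe_smul, Pi.sub_apply, Pi.smul_apply]
  rw [hy' μ, map_sub, eq_sub_of_add_eq e.symm]
  module

/-- If `z = -μ x + u + φ(conj μ)* y` lies in the state space, then `x` and
`stateSolve φ b (b x - z, u)` are both quotients of `b x - z + u` by `b + μ`, so they agree by
uniqueness. -/
lemma mem_domain_of_embedding_eq {a₀ : CPlus}
    (hcond : ∀ (y : Y) (h : StateSpace φ), IsQuotientFor φ a₀ 0 y h → h = 0)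
    {x z : StateSpace φ} {u : U} (hz : embedding φ b z = extendedMain φ b x + control φ b u) :
    (x, u) ∈ (node φ).domain := by
  rw [extendedMain_add_control, embedding_eq_mk, mk_eq_mk_iff] at hz
  obtain ⟨y, hy⟩ := hz
  obtain ⟨y', hy'⟩ := stateSolve_quotient φ b ((b : ℂ) • x - z) u
  have hx : IsQuotientFor φ b (fun μ => ((b : ℂ) • x - z) μ + u) y x := by
    refine (isQuotientFor_iff ..).mpr fun μ => ?_
    rw [← hy μ]
    simp only [RKHS.coe_sub, RKHS.coe_smul, Pi.sub_apply, Pi.smul_apply]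
    module
  obtain ⟨z', y'', hp, -⟩ := stateSolve_spec φ b ((b : ℂ) • x - z) u
  rw [← quotient_unique φ hcond hx hy'] at hp
  exact (mem_node_domain φ x u).mpr ⟨_, _, hp⟩

end ExtrapSpace

end ExtrapModel

open ExtrapSpace in
theorem theorem4p13 {U Y : Type*}
    [NormedAddCommGroup U] [InnerProductSpace ℂ U] [CompleteSpace U]
    [NormedAddCommGroup Y] [InnerProductSpace ℂ Y] [CompleteSpace Y]
    (φ : SchurClass U Y) (b : CPlus) (a₀ : CPlus)
    -- the state space contains no nonzero function `φ(conj μ)* y / (a₀ + μ)`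
    (hcond : ∀ (y : Y) (h : StateSpace φ),
      (∀ μ : CPlus, h μ = ((a₀ : ℂ) + (μ : ℂ))⁻¹ • φ.tilde μ y) → h = 0) :
    -- the term `φ(conj μ)* y` in the definition of the space is unique,
    (∀ (x : CPlus → U) (y y' : Y) (h h' : StateSpace φ),
      IsQuotientFor φ b x y h → IsQuotientFor φ b x y' h' →
        (∀ μ : CPlus, φ.tilde μ y = φ.tilde μ y') ∧ h = h') ∧
    -- the norm is given by the explicit formula, is definite, and the space is complete
    (∀ (x : CPlus → U) (hx : x ∈ extrapFunctions φ b) (y : Y) (h : StateSpace φ),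
      IsQuotientFor φ b x y h → ‖ExtrapSpace.mk x hx‖ = ‖h‖) ∧
    (∀ ξ : ExtrapSpace φ b, ‖ξ‖ = 0 → ξ = 0) ∧
    CompleteSpace (ExtrapSpace φ b) ∧
    ∃ (R : StateSpace φ →L[ℂ] StateSpace φ) (j T : StateSpace φ →L[ℂ] ExtrapSpace φ b)
      (V : ExtrapSpace φ b ≃ₗᵢ[ℂ] StateSpace φ) (B : U →L[ℂ] ExtrapSpace φ b),
      -- the space is the completion of the state space in the norm `‖(b - A)⁻¹ x‖`
      IsResolventAt (mainOperator (node φ)) (b : ℂ) R ∧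
      (∀ x : StateSpace φ, ∃ hx : ⇑x ∈ extrapFunctions φ b, j x = ExtrapSpace.mk ⇑x hx) ∧
      Function.Injective j ∧
      DenseRange j ∧
      (∀ x : StateSpace φ, ‖j x‖ = ‖R x‖) ∧
      -- the range of the embedding, with "for some" and with "for every"
      (∀ (z : CPlus → U) (hz : z ∈ extrapFunctions φ b),
        ((∃ x : StateSpace φ, j x = ExtrapSpace.mk z hz) ↔
          ∃ (a : CPlus) (y : Y), ∃ g ∈ (mainOperator (node φ)).domain,
            IsQuotientFor φ a z y g) ∧
        ((∃ x : StateSpace φ, j x = ExtrapSpace.mk z hz) ↔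
          ∀ a : CPlus, ∃ y : Y, ∃ g ∈ (mainOperator (node φ)).domain,
            IsQuotientFor φ a z y g)) ∧
      -- the unique continuous extension of the main operator
      (∀ x : StateSpace φ, ∃ hx : (fun μ : CPlus => -((μ : ℂ) • x μ)) ∈ extrapFunctions φ b,
        T x = ExtrapSpace.mk (fun μ : CPlus => -((μ : ℂ) • x μ)) hx) ∧
      IsExtensionOf (mainOperator (node φ)) j T ∧
      (∀ T' : StateSpace φ →L[ℂ] ExtrapSpace φ b,
        IsExtensionOf (mainOperator (node φ)) j T' → T' = T) ∧
      -- the unitary operator `V` is the inverse of `b - T` and is given by the explicit formula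
      (∀ x : StateSpace φ, V.symm x = (b : ℂ) • j x - T x) ∧
      (∀ (x : CPlus → U) (hx : x ∈ extrapFunctions φ b) (y : Y),
        (∃ h : StateSpace φ, IsQuotientFor φ b x y h) →
          ∀ μ : CPlus, V (ExtrapSpace.mk x hx) μ =
            ((b : ℂ) + (μ : ℂ))⁻¹ • (x μ + φ.tilde μ y)) ∧
      -- the control operator
      (∀ u : U, ∃ hu : (fun _ : CPlus => u) ∈ extrapFunctions φ b,
        B u = ExtrapSpace.mk (fun _ : CPlus => u) hu) ∧
      IsControlOperator (node φ) j T B ∧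
      (∀ B' : U →L[ℂ] ExtrapSpace φ b, IsControlOperator (node φ) j T B' → B' = B) ∧
      (∀ (x : StateSpace φ) (u : U),
        (x, u) ∈ (node φ).domain ↔ ∃ z : StateSpace φ, j z = T x + B u) := by

  have hc : ∀ (y : Y) (h : StateSpace φ), IsQuotientFor φ a₀ 0 y h → h = 0 :=
    fun y h hh => hcond y h fun μ => by simpa using hh μ
  have hnorm := fun (x : CPlus → U) (hx : x ∈ extrapFunctions φ b) (y : Y) (h : StateSpace φ)
    (hh : IsQuotientFor φ b x y h) => norm_mk_eq hc hx hh
  have hdef : ∀ ξ : ExtrapSpace φ b, ‖ξ‖ = 0 → ξ = 0 := by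
    intro ξ h
    rwa [← (stateEquiv (b := b) hc).symm.norm_map, norm_eq_zero,
      LinearIsometryEquiv.map_eq_zero_iff] at h
  refine ⟨?_, hnorm, hdef, ?_, mainResolvent φ b, embedding φ b, extendedMain φ b,
    (stateEquiv hc).symm, control φ b, mainResolvent_isResolventAt φ b,
    fun x => ⟨coe_mem x, embedding_eq_mk x⟩,
    (ofState_injective hc).comp (mainResolvent_injective φ b), ?_,
    fun x => norm_ofState hc _, fun z hz => ⟨⟨?_, ?_⟩, ⟨?_, ?_⟩⟩,
    fun x => ⟨neg_mul_mem x, extendedMain_eq_mk x⟩, isExtensionOf_extendedMain,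
    fun T' hT' => extension_unique hdef hT', ?_, ?_, fun u => ⟨const_mem u, control_eq_mk u⟩,
    isControlOperator_control, fun B' hB' => control_unique hB', fun x u => ⟨?_, ?_⟩⟩
  · intro x y y' h h' hh hh'
    obtain rfl := quotient_unique φ hc hh hh'
    exact ⟨tilde_eq_of_quotient φ hh hh', rfl⟩
  · exact ((stateEquiv (b := b) hc).symm.isometry.isUniformInducing.completeSpace_congr
      (stateEquiv (b := b) hc).symm.surjective).mpr inferInstance
  · exact (stateEquiv (b := b) hc).surjective.denseRange.comp (mainResolvent_denseRange φ b)
      (stateEquiv (b := b) hc).continuous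
  · rintro ⟨x, hx⟩
    exact ⟨b, exists_quotient_of_range hz hx b⟩
  · rintro ⟨a, y, g, hg, h⟩
    exact range_of_exists_quotient hz hg h
  · rintro ⟨x, hx⟩ a
    exact exists_quotient_of_range hz hx a
  · intro H
    obtain ⟨y, g, hg, h⟩ := H b
    exact range_of_exists_quotient hz hg h
  · intro x
    rw [LinearIsometryEquiv.symm_symm, extendedMain_apply, sub_sub_cancel]
    rfl
  · rintro x hx y ⟨h, hh⟩ μ
    rw [← hh μ]
    have : (stateEquiv hc).symm (mk x hx) = h := by
      rw [LinearIsometryEquiv.symm_apply_eq]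
      exact ((ofState_eq_mk_iff hx h).mpr ⟨y, hh⟩).symm
    rw [this]
  · intro hxu
    exact ⟨_, isControlOperator_control ⟨_, hxu⟩⟩
  · rintro ⟨z, hz⟩
    exact mem_domain_of_embedding_eq hc hz
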